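/- **Data.** Let $\rho>0$ and let $\mu_1,\mu_2\in\mathbb R^d$ be orthogonal with $\|\mu_1\|=\|\mu_2\|=\rho$; let $\eta\in[0,1/2)$. A data point $(X,y)\sim\mathcal D$, with $X=(x^{(1)},x^{(2)})^\top\in\mathbb R^{2\times d}$ and $y\in\{\pm1\}$, is generated by independent choices as follows. Draw $\tilde y\sim\mathrm{Unif}\{\pm1\}$ and set $u=\mu_1$ if $\tilde y=1$, $u=\mu_2$ if $\tilde y=-1$; draw $\xi\sim\mathcal N(0,\,I_d-\mu_1\mu_1^\top/\rho^2-\mu_2\mu_2^\top/\rho^2)$; draw $k\sim\mathrm{Unif}\{1,2\}$ and set $x^{(k)}=u$ (the signal token) and $x^{(3-k)}=\xi$ (the noise token); finally let $y=\tilde y$ with probability $1-\eta$ and $y=-\tilde y$ with probability $\eta$. The training set $(X_i,y_i)_{i=1}^n$ is drawn i.i.d. from $\mathcal D$. Let $\mathcal C=\{i:y_i=\tilde y_i\}$ be the set of clean samples and $\mathcal N=\{i:y_i=-\tilde y_i\}$ the set of noisy samples. **Model and training.** For $v,p\in\mathbb R^d$ let $f(X;p,v)=v^\top X^\top\mathbb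 S(Xp)$, where $\mathbb S$ is the softmax, $\mathbb S(z)_j=e^{z_j}/\sum_l e^{z_l}$. Let $\mathcal L(v,p)=\frac1n\sum_{i=1}^n\log\bigl(1+\exp(-y_if(X_i;p,v))\bigr)$, $v_0=p_0=0$, and for $t\ge 0$ $$v_{t+1}=v_t-\beta\nabla_v\mathcal L(v_t,p_t),\qquad p_{t+1}=p_t-\beta\nabla_p\mathcal L(v_t,p_t).$$ Let $s_{i,\mathrm{sig}}$ and $s_{i,\mathrm{noise}}$ be the entries of $\mathbb S(X_ip_2)$ at the positions of the signal token and of the noise token of sample $i$. **Theorem.** For all constants $C_\rho\ge 6$ and $C_\beta\ge 16$ there are a constant $C_1>0$ and a constant $C_0>0$, depending only on $C_\rho$ and $C_\beta$, such that the following holds for every $C\ge C_0$. Let $\delta\in(0,1/2)$ and suppose that 1. $n\ge C\log(1/\delta)$, 2. $d\ge Cn^2\log(n/\delta)$, 3. $\rho=C_\rho\sqrt{d/n}$, 4. $\eta\le 1/C$, 5. $\beta=C_\beta\, n/d$. Then, with probability at least $1-\delta$ over the training set, all of the following hold: * $s_{i,\mathrm{sig}}>1/2$ for all $i\in\mathcal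 C$, and $s_{i,\mathrm{noise}}\ge 1-1/C_\rho^2$ for all $i\in\mathcal N$; * $y_i=\mathrm{sign}(f(X_i;p_2,v_2))$ for all $i\in\{1,\dots,n\}$; * $\mathbb P_{(X,y)\sim\mathcal D}\bigl(y\ne\mathrm{sign}(f(X;p_2,v_2))\bigr)\le\eta+\exp\bigl(-d/(C_1n^2)\bigr)$. -/

import Mathlib

open MeasureTheory ProbabilityTheory

noncomputable section

namespace AttentionGD

/-! ### Data distribution -/

/-- Token vectors in `ℝ^d`, with the Euclidean norm and inner product. -/
abbrev Token (d : ℕ) : Type := EuclideanSpace ℝ (Fin d)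

/-- An input `X ∈ ℝ^{2 × d}`: its two rows are the two tokens. -/
abbrev Input (d : ℕ) : Type := Fin 2 → Token d

/-- Labels `±1`. -/
abbrev Label : Type := ℤˣ

/-- The label `±1` as a real number. -/
def Label.toReal (y : Label) : ℝ := ((y : ℤ) : ℝ)

/-- The covariance matrix `I_d - μ₁ μ₁ᵀ / ρ² - μ₂ μ₂ᵀ / ρ²`. -/
def noiseCov {d : ℕ} (ρ : ℝ) (μ₁ μ₂ : Token d) : Matrix (Fin d) (Fin d) ℝ :=
  1 - (ρ ^ 2)⁻¹ • Matrix.vecMulVec μ₁.ofLp μ₁.ofLp - (ρ ^ 2)⁻¹ • Matrix.vecMulVec μ₂.ofLp μ₂.ofLp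

/-- The outcome of all the random choices behind one labelled data point. -/
abbrev Draw (d : ℕ) : Type := Label × Label × Fin 2 × Token d

namespace Draw

variable {d : ℕ}

/-- The label `ỹ` before flipping. -/
def cleanLabel (ω : Draw d) : Label := ω.1

/-- The flip: `1` if the label is kept and `-1` if it is flipped. -/
def flip (ω : Draw d) : Label := ω.2.1

/-- The position `k` of the signal token. -/
def pos (ω : Draw d) : Fin 2 := ω.2.2.1

/-- The noise vector `ξ`. -/
def noise (ω : Draw d) : Token d := ω.2.2.2

/-- The observed label `y`. -/
def label (ω : Draw d) : Label := ω.flip * ω.cleanLabel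

/-- The signal vector: `μ₁` if `ỹ = 1` and `μ₂` if `ỹ = -1`. -/
def signal (μ₁ μ₂ : Token d) (ω : Draw d) : Token d := if ω.cleanLabel = 1 then μ₁ else μ₂

/-- The input `X`: the signal stands in row `k`, the noise in the other row. -/
def input (μ₁ μ₂ : Token d) (ω : Draw d) : Input d :=
  fun j => if j = ω.pos then ω.signal μ₁ μ₂ else ω.noise

/-- The data point `(X, y)`. -/
def dataPoint (μ₁ μ₂ : Token d) (ω : Draw d) : Input d × Label := (ω.input μ₁ μ₂, ω.label)

/-- The other position `3 - k`, which holds the noise token. -/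
def noisePos (ω : Draw d) : Fin 2 := Fin.rev ω.pos

end Draw

/-- The law of the flip: `-1` with probability `η` and `1` with probability `1 - η`. -/
def flipLaw (η : ℝ) : Measure Label :=
  ENNReal.ofReal (1 - η) • Measure.dirac 1 + ENNReal.ofReal η • Measure.dirac (-1)

/-- The joint law of the independent choices: clean label uniform on `±1`, flip with probability
`η`, signal position uniform, and Gaussian noise `N(0, I - μ₁ μ₁ᵀ / ρ² - μ₂ μ₂ᵀ / ρ²)`. -/
def drawLaw {d : ℕ} (η ρ : ℝ) (μ₁ μ₂ : Token d) : Measure (Draw d) :=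
  (PMF.uniformOfFintype Label).toMeasure.prod
    ((flipLaw η).prod
      ((PMF.uniformOfFintype (Fin 2)).toMeasure.prod
        (multivariateGaussian 0 (noiseCov ρ μ₁ μ₂))))

/-- The distribution `𝒟` of a labelled data point `(X, y)` with label-flipping noise. -/
def dataLaw {d : ℕ} (η ρ : ℝ) (μ₁ μ₂ : Token d) : Measure (Input d × Label) :=
  (drawLaw η ρ μ₁ μ₂).map (Draw.dataPoint μ₁ μ₂)

/-- The joint law of the random choices behind `n` i.i.d. data points. -/
def trainLaw {d : ℕ} (n : ℕ) (η ρ : ℝ) (μ₁ μ₂ : Token d) : Measure (Fin n → Draw d) :=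
  Measure.pi fun _ => drawLaw η ρ μ₁ μ₂

/-- The training set `(X_i, y_i)` that results from the random choices. -/
def trainSet {d n : ℕ} (μ₁ μ₂ : Token d) (ω : Fin n → Draw d) : Fin n → Input d × Label :=
  fun i => (ω i).dataPoint μ₁ μ₂

/-- The indices of clean examples. -/
def cleanIdx {d n : ℕ} (ω : Fin n → Draw d) : Set (Fin n) :=
  {i | (ω i).label = (ω i).cleanLabel}

/-- The indices of noisy examples. -/
def noisyIdx {d n : ℕ} (ω : Fin n → Draw d) : Set (Fin n) :=
  {i | (ω i).label = -(ω i).cleanLabel}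

/-! ### Model and gradient descent -/

/-- The softmax function. -/
def softmax {m : ℕ} (z : Fin m → ℝ) : Fin m → ℝ :=
  fun j => Real.exp (z j) / ∑ l, Real.exp (z l)

/-- The attention weights `𝕊(X p)`. -/
def attn {d : ℕ} (X : Input d) (p : Token d) : Fin 2 → ℝ :=
  softmax fun j => inner ℝ (X j) p

/-- The model `f(X; p, v) = vᵀ Xᵀ 𝕊(X p)`. -/
def model {d : ℕ} (v p : Token d) (X : Input d) : ℝ :=
  inner ℝ v (∑ j, attn X p j • X j)

/-- The logistic loss `ℓ(z) = log (1 + exp (-z))`. -/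
def logisticLoss (z : ℝ) : ℝ := Real.log (1 + Real.exp (-z))

/-- The empirical risk. -/
def risk {d n : ℕ} (S : Fin n → Input d × Label) (v p : Token d) : ℝ :=
  (1 / (n : ℝ)) * ∑ i, logisticLoss ((S i).2.toReal * model v p (S i).1)

/-- The iterates `(v_t, p_t)` of gradient descent with step size `β`, started at zero. -/
def gd {d n : ℕ} (S : Fin n → Input d × Label) (β : ℝ) : ℕ → Token d × Token d
  | 0 => (0, 0)
  | t + 1 =>
    let v := (gd S β t).1
    let p := (gd S β t).2
    (v - β • gradient (fun v' => risk S v' p) v, p - β • gradient (fun p' => risk S v p') p)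

/-- The probability under `𝒟` that the classifier `X ↦ sign (f(X; p, v))` errs. -/
def testError {d : ℕ} (η ρ : ℝ) (μ₁ μ₂ v p : Token d) : ℝ :=
  (dataLaw η ρ μ₁ μ₂).real {z | z.2.toReal ≠ Real.sign (model v p z.1)}

end AttentionGD

end

open AttentionGD

/-! Two gradient steps can be written out explicitly and then estimated on a typical training set.
Put `K = Cβ` and `R = Cρ²`, so that `β ρ² = K R` and `β d / n = K`. Since `v₀ = 0`, the first step
leaves `p₁ = 0` and gives `v₁ = (β/4n) ∑ yᵢ (uᵢ + ξᵢ)`. Noise tokens are orthogonal to the signals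
and nearly orthogonal to each other, so `ỹ ⟨v₁, u⟩` is of order `K R`, while the memorised part `yᵢ
⟨v₁, ξᵢ⟩` is only of order `K`. Hence clean samples have a large positive margin and a loss weight
between `exp(-KR/4)/2` and `exp(-3KR/100)`; noisy samples have a negative margin and a weight of at
least `9/10`.

The second step (`gd_two`) gives `p₂ = (β/4n) ∑ ± wᵢ (uᵢ - ξᵢ)` with `wᵢ > 0`, the sign being plus
on clean and minus on noisy samples. Clean samples pull `p` towards the signal and away from their
own noise; noisy ones do the reverse. `⟨p₂, u⟩` is positive because the noisy fraction is at most `ε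
= exp(-KR/4)/100`, small enough for even the tiny clean weights to win. It is bounded by a constant
because the clean weights are exponentially small (`Scaled.p_signal`). On a noisy sample `⟨p₂, ξᵢ⟩`
is at least `(8/100) K R`, so the noise token takes almost all the attention
(`Scaled.p_noise_noisy`).

Meanwhile `v₂` has the correct sign on the signals and the observed sign on every training noise
token. On a noisy sample the wrong signal term, of order `K R`, is damped by attention at most `1/R`
and loses to the memorised noise term of order `K` (`Scaled.label_eq_sign`). For a fresh point,
`⟨v₂, ξ⟩` and `⟨p₂, ξ⟩` are centred Gaussians of variance `O(n²/d)`, so outside an exponentially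
small event the signal decides (`Scaled.testError_le`). The probabilistic input is
`measureReal_isGood_ge`; everything after it is deterministic, up to the Gaussian tail of the test
point. -/

namespace AttentionGD

/-! ### Gaussian noise on the orthogonal complement of the signals -/

open Matrix in
open scoped MatrixOrder in
/-- A symmetric idempotent matrix is its own nonnegative square root. -/
lemma sqrt_eq_self_of_idempotent {d : ℕ} {A : Matrix (Fin d) (Fin d) ℝ} (h : Aᴴ = A)
    (h2 : A * A = A) : CFC.sqrt A = A := by
  have hA : A.PosSemidef := by
    rw [← h2]
    nth_rw 1 [← h]
    exact Matrix.posSemidef_conjTranspose_mul_self A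
  exact CFC.sqrt_unique h2 hA.nonneg

/-- The linear map `x ↦ x - ρ⁻² ⟪μ₁, x⟫ μ₁ - ρ⁻² ⟪μ₂, x⟫ μ₂` given by the noise covariance. -/
noncomputable def noiseProj {d : ℕ} (ρ : ℝ) (μ₁ μ₂ : Token d) : Token d →L[ℝ] Token d :=
  Matrix.toEuclideanCLM (𝕜 := ℝ) (noiseCov ρ μ₁ μ₂)

section

variable {d : ℕ} {ρ : ℝ} {μ₁ μ₂ : Token d}

lemma noiseProj_apply (ρ : ℝ) (μ₁ μ₂ x : Token d) :
    noiseProj ρ μ₁ μ₂ x = x - ((ρ ^ 2)⁻¹ * inner ℝ μ₁ x) • μ₁ - ((ρ ^ 2)⁻¹ * inner ℝ μ₂ x) • μ₂ := by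
  ext i
  simp only [noiseProj, Matrix.ofLp_toEuclideanCLM, noiseCov, Matrix.sub_mulVec,
    Matrix.smul_mulVec, Matrix.one_mulVec, Matrix.vecMulVec_mulVec, Pi.sub_apply, Pi.smul_apply,
    PiLp.sub_apply, PiLp.smul_apply, smul_eq_mul]
  simp [EuclideanSpace.inner_eq_star_dotProduct, dotProduct_comm, mul_comm, mul_left_comm]
  ring

lemma inner_noiseProj_signal (hρ : 0 < ρ) (h₁ : ‖μ₁‖ = ρ) (h₂ : ‖μ₂‖ = ρ)
    (h : inner ℝ μ₁ μ₂ = 0) (x : Token d) :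
    inner ℝ μ₁ (noiseProj ρ μ₁ μ₂ x) = 0 ∧ inner ℝ μ₂ (noiseProj ρ μ₁ μ₂ x) = 0 := by
  have h' : inner ℝ μ₂ μ₁ = 0 := by rw [real_inner_comm]; exact h
  have hρ' : ρ ≠ 0 := hρ.ne'
  simp only [noiseProj_apply, inner_sub_right, real_inner_smul_right, h, h',
    real_inner_self_eq_norm_sq, h₁, h₂]
  constructor <;> field_simp <;> ring

lemma noiseProj_noiseProj (hρ : 0 < ρ) (h₁ : ‖μ₁‖ = ρ) (h₂ : ‖μ₂‖ = ρ)
    (h : inner ℝ μ₁ μ₂ = 0) (x : Token d) :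
    noiseProj ρ μ₁ μ₂ (noiseProj ρ μ₁ μ₂ x) = noiseProj ρ μ₁ μ₂ x := by
  obtain ⟨e₁, e₂⟩ := inner_noiseProj_signal hρ h₁ h₂ h x
  rw [noiseProj_apply ρ μ₁ μ₂ (noiseProj ρ μ₁ μ₂ x), e₁, e₂]
  simp

lemma inner_noiseProj_left (x y : Token d) :
    inner ℝ (noiseProj ρ μ₁ μ₂ x) y = inner ℝ x (noiseProj ρ μ₁ μ₂ y) := by
  simp only [noiseProj_apply, inner_sub_left, inner_sub_right, real_inner_smul_right,
    real_inner_comm]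
  ring

lemma noiseProj_eq_self {x : Token d} (h₁ : inner ℝ μ₁ x = 0) (h₂ : inner ℝ μ₂ x = 0) :
    noiseProj ρ μ₁ μ₂ x = x := by
  simp [noiseProj_apply, h₁, h₂]

lemma norm_sq_noiseProj (hρ : 0 < ρ) (h₁ : ‖μ₁‖ = ρ) (h₂ : ‖μ₂‖ = ρ)
    (h : inner ℝ μ₁ μ₂ = 0) (x : Token d) :
    ‖noiseProj ρ μ₁ μ₂ x‖ ^ 2 =
      ‖x‖ ^ 2 - (inner ℝ (ρ⁻¹ • μ₁) x) ^ 2 - (inner ℝ (ρ⁻¹ • μ₂) x) ^ 2 := by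
  rw [← real_inner_self_eq_norm_sq, inner_noiseProj_left, noiseProj_noiseProj hρ h₁ h₂ h,
    noiseProj_apply]
  simp only [inner_sub_right, real_inner_smul_right,
    real_inner_self_eq_norm_sq, real_inner_comm]
  have hρ' : ρ ≠ 0 := hρ.ne'
  field_simp

-- The covariance is an orthogonal projection, hence its own square root; so the noise is a
-- projected standard Gaussian, and every noise estimate reduces to the standard one.
open scoped MatrixOrder in
lemma multivariateGaussian_noiseCov (hρ : 0 < ρ) (h₁ : ‖μ₁‖ = ρ) (h₂ : ‖μ₂‖ = ρ)
    (h : inner ℝ μ₁ μ₂ = 0) :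
    multivariateGaussian 0 (noiseCov ρ μ₁ μ₂) =
      (stdGaussian (Token d)).map (noiseProj ρ μ₁ μ₂) := by
  have hs : CFC.sqrt (noiseCov ρ μ₁ μ₂) = noiseCov ρ μ₁ μ₂ := by
    apply sqrt_eq_self_of_idempotent
    · ext i j
      simp [noiseCov, Matrix.vecMulVec_apply, Matrix.one_apply, eq_comm, mul_comm]
    · apply (Matrix.toEuclideanCLM (n := Fin d) (𝕜 := ℝ)).injective
      rw [map_mul]
      ext1 x
      exact noiseProj_noiseProj hρ h₁ h₂ h x
  rw [multivariateGaussian, hs]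
  simp [noiseProj]

lemma hasSubgaussianMGF_inner_stdGaussian (w : Token d) :
    HasSubgaussianMGF (fun x => inner ℝ w x) (‖w‖₊ ^ 2) (stdGaussian (Token d)) := by
  have hm : (stdGaussian (Token d)).map (innerSL ℝ w) = gaussianReal 0 (‖w‖₊ ^ 2) := by
    rw [IsGaussian.map_eq_gaussianReal, variance_dual_stdGaussian, integral_strongDual_stdGaussian]
    congr 1
    ext
    simp
  have hf : (fun x => inner ℝ w x) = (innerSL ℝ w : Token d → ℝ) := by ext; simp
  rw [hf]
  constructor
  · intro t
    have := integrable_exp_mul_gaussianReal (μ := 0) (v := ‖w‖₊ ^ 2) t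
    rw [← hm, integrable_map_measure (by fun_prop) (by fun_prop)] at this
    exact this
  · intro t
    rw [mgf_gaussianReal hm]
    simp

/-- The projection is self-adjoint, so it can be moved onto `w` and only the projected part of `w`
contributes variance. Taking an upper bound `s > 0` for that variance also covers a vanishing
projection. -/
lemma measureReal_inner_noise_ge (hρ : 0 < ρ) (h₁ : ‖μ₁‖ = ρ) (h₂ : ‖μ₂‖ = ρ)
    (h : inner ℝ μ₁ μ₂ = 0) (w : Token d) {s t : ℝ} (hs : 0 < s) (ht : 0 ≤ t)
    (hw : ‖noiseProj ρ μ₁ μ₂ w‖ ^ 2 ≤ s) :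
    (multivariateGaussian 0 (noiseCov ρ μ₁ μ₂)).real {x | t ≤ inner ℝ w x} ≤
      Real.exp (-t ^ 2 / (2 * s)) := by
  rw [multivariateGaussian_noiseCov hρ h₁ h₂ h,
    map_measureReal_apply (by fun_prop) (measurableSet_le (by fun_prop) (by fun_prop))]
  have hset : noiseProj ρ μ₁ μ₂ ⁻¹' {x | t ≤ inner ℝ w x} =
      {x | t ≤ inner ℝ (noiseProj ρ μ₁ μ₂ w) x} := by
    ext x
    simp [inner_noiseProj_left]
  rw [hset]
  set z := noiseProj ρ μ₁ μ₂ w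
  have hsub := hasSubgaussianMGF_inner_stdGaussian z
  have hsub' : HasSubgaussianMGF (fun x => inner ℝ z x) ⟨s, hs.le⟩ (stdGaussian (Token d)) := by
    refine ⟨hsub.integrable_exp_mul, fun u => (hsub.mgf_le u).trans ?_⟩
    apply Real.exp_le_exp.2
    have : ((‖z‖₊ ^ 2 : NNReal) : ℝ) ≤ s := by simpa using hw
    change ((‖z‖₊ ^ 2 : NNReal) : ℝ) * u ^ 2 / 2 ≤ s * u ^ 2 / 2
    gcongr
  exact hsub'.measure_ge_le ht

lemma ae_noise_orthogonal (hρ : 0 < ρ) (h₁ : ‖μ₁‖ = ρ) (h₂ : ‖μ₂‖ = ρ)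
    (h : inner ℝ μ₁ μ₂ = 0) :
    ∀ᵐ x ∂(multivariateGaussian 0 (noiseCov ρ μ₁ μ₂)), inner ℝ μ₁ x = 0 ∧ inner ℝ μ₂ x = 0 := by
  rw [multivariateGaussian_noiseCov hρ h₁ h₂ h, ae_map_iff (by fun_prop)]
  · exact Filter.Eventually.of_forall fun x => inner_noiseProj_signal hρ h₁ h₂ h x
  · exact (measurableSet_eq_fun (by fun_prop) (by fun_prop)).inter
      (measurableSet_eq_fun (by fun_prop) (by fun_prop))

end

/-! ### The squared norm of a Gaussian vector -/

lemma gaussian_exp_mul_sq {t : ℝ} (ht : t < 1 / 2) :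
    Integrable (fun x => Real.exp (t * x ^ 2)) (gaussianReal 0 1) ∧
      ∫ x, Real.exp (t * x ^ 2) ∂(gaussianReal 0 1) = √(1 / (1 - 2 * t)) := by
  have hpdf : ∀ x : ℝ, gaussianPDFReal 0 1 x * Real.exp (t * x ^ 2) =
      (√(2 * Real.pi))⁻¹ * Real.exp (-(1 / 2 - t) * x ^ 2) := by
    intro x
    simp only [gaussianPDFReal, NNReal.coe_one, mul_one, sub_zero]
    rw [mul_assoc, ← Real.exp_add]
    ring_nf
  constructor
  · rw [gaussianReal_of_var_ne_zero _ one_ne_zero,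
      integrable_withDensity_iff_integrable_smul₀' (by fun_prop)
        (Filter.Eventually.of_forall fun x => gaussianPDF_lt_top)]
    have : (fun x => (gaussianPDF 0 1 x).toReal • Real.exp (t * x ^ 2)) =
        fun x => (√(2 * Real.pi))⁻¹ * Real.exp (-(1 / 2 - t) * x ^ 2) := by
      ext x
      rw [toReal_gaussianPDF, smul_eq_mul, hpdf]
    rw [this]
    exact (integrable_exp_neg_mul_sq (by linarith)).const_mul _
  · rw [integral_gaussianReal_eq_integral_smul one_ne_zero]
    simp_rw [smul_eq_mul, hpdf]
    rw [integral_const_mul, integral_gaussian, ← Real.sqrt_inv, ← Real.sqrt_mul (by positivity)]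
    congr 1
    have : (1 / 2 - t) ≠ 0 := by linarith
    have : (1 - 2 * t) ≠ 0 := by linarith
    field_simp

lemma mgf_norm_sq_stdGaussian {d : ℕ} {t : ℝ} (ht : t < 1 / 2) :
    Integrable (fun x => Real.exp (t * ‖x‖ ^ 2)) (stdGaussian (Token d)) ∧
      mgf (fun x => ‖x‖ ^ 2) (stdGaussian (Token d)) t = √(1 / (1 - 2 * t)) ^ d := by
  have hf : (fun x : Fin d → ℝ => Real.exp (t * ‖(WithLp.toLp 2 x : Token d)‖ ^ 2)) =
      fun x => ∏ i, Real.exp (t * x i ^ 2) := by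
    ext x
    rw [EuclideanSpace.real_norm_sq_eq, Finset.mul_sum, Real.exp_sum]
  constructor
  · rw [← map_pi_eq_stdGaussian, integrable_map_measure (by fun_prop) (by fun_prop)]
    change Integrable (fun x : Fin d → ℝ => Real.exp (t * ‖(WithLp.toLp 2 x : Token d)‖ ^ 2)) _
    rw [hf]
    exact Integrable.fintype_prod (f := fun _ y => Real.exp (t * y ^ 2))
      fun _ => (gaussian_exp_mul_sq ht).1
  · rw [mgf, ← map_pi_eq_stdGaussian, integral_map (by fun_prop) (by fun_prop), hf,
      integral_fintype_prod_eq_pow (fun y : ℝ => Real.exp (t * y ^ 2)), (gaussian_exp_mul_sq ht).2,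
      Fintype.card_fin]

lemma stdGaussian_norm_sq_ge (d : ℕ) :
    (stdGaussian (Token d)).real {x | 2 * (d : ℝ) ≤ ‖x‖ ^ 2} ≤ Real.exp (-(d : ℝ) / 50) := by
  -- Chernoff at `t = 1/4`: the exponent per dimension is `(log 2 - 1)/2`, below `-1/50`.
  obtain ⟨hi, hm⟩ := mgf_norm_sq_stdGaussian (d := d) (t := 1 / 4) (by norm_num)
  refine (measure_ge_le_exp_mul_mgf (2 * (d : ℝ)) (by norm_num) hi).trans ?_
  rw [hm]
  have h2 : √(1 / (1 - 2 * (1 / 4 : ℝ))) = Real.exp (Real.log 2 / 2) := by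
    rw [← Real.log_sqrt (by norm_num), Real.exp_log (by positivity)]
    norm_num
  rw [h2, ← Real.exp_nat_mul, ← Real.exp_add]
  apply Real.exp_le_exp.2
  have := Real.log_two_lt_d9
  have hd : (0 : ℝ) ≤ d := Nat.cast_nonneg d
  nlinarith

lemma stdGaussian_norm_sq_le (d : ℕ) :
    (stdGaussian (Token d)).real {x | ‖x‖ ^ 2 ≤ 3 / 5 * (d : ℝ)} ≤ Real.exp (-(d : ℝ) / 50) := by
  -- Chernoff at `t = -1/2`: the exponent per dimension is `3/10 - (log 2)/2`, about `-0.047`.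
  obtain ⟨hi, hm⟩ := mgf_norm_sq_stdGaussian (d := d) (t := -1 / 2) (by norm_num)
  refine (measure_le_le_exp_mul_mgf (3 / 5 * (d : ℝ)) (by norm_num) hi).trans ?_
  rw [hm]
  have h2 : √(1 / (1 - 2 * (-1 / 2 : ℝ))) = Real.exp (-(Real.log 2 / 2)) := by
    rw [Real.exp_neg, ← Real.log_sqrt (by norm_num), Real.exp_log (by positivity),
      ← Real.sqrt_inv]
    norm_num
  rw [h2, ← Real.exp_nat_mul, ← Real.exp_add]
  apply Real.exp_le_exp.2
  have := Real.log_two_gt_d9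
  have hd : (0 : ℝ) ≤ d := Nat.cast_nonneg d
  nlinarith

section

variable {d : ℕ} {ρ : ℝ} {μ₁ μ₂ : Token d}

lemma measureReal_noise_norm_sq_gt (hρ : 0 < ρ) (h₁ : ‖μ₁‖ = ρ) (h₂ : ‖μ₂‖ = ρ)
    (h : inner ℝ μ₁ μ₂ = 0) :
    (multivariateGaussian 0 (noiseCov ρ μ₁ μ₂)).real {x | 2 * (d : ℝ) < ‖x‖ ^ 2} ≤
      Real.exp (-(d : ℝ) / 50) := by
  rw [multivariateGaussian_noiseCov hρ h₁ h₂ h,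
    map_measureReal_apply (by fun_prop) (measurableSet_lt (by fun_prop) (by fun_prop))]
  refine le_trans (measureReal_mono ?_) (stdGaussian_norm_sq_ge d)
  intro x hx
  simp only [Set.mem_preimage, Set.mem_ofPred_eq, norm_sq_noiseProj hρ h₁ h₂ h] at hx ⊢
  nlinarith [sq_nonneg (inner ℝ (ρ⁻¹ • μ₁) x), sq_nonneg (inner ℝ (ρ⁻¹ • μ₂) x)]

lemma stdGaussian_inner_sq_ge {w : Token d} (hw : ‖w‖ = 1) :
    (stdGaussian (Token d)).real {x | (d : ℝ) / 20 ≤ (inner ℝ w x) ^ 2} ≤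
      2 * Real.exp (-(d : ℝ) / 50) := by
  have key : ∀ w : Token d, ‖w‖ = 1 →
      (stdGaussian (Token d)).real {x | √((d : ℝ) / 20) ≤ inner ℝ w x} ≤
        Real.exp (-(d : ℝ) / 50) := by
    intro w hw
    refine ((hasSubgaussianMGF_inner_stdGaussian w).measure_ge_le (Real.sqrt_nonneg _)).trans ?_
    apply Real.exp_le_exp.2
    have hd : (0 : ℝ) ≤ d := Nat.cast_nonneg d
    rw [Real.sq_sqrt (by positivity)]
    simp only [NNReal.coe_pow, coe_nnnorm, hw]
    linarith
  have hsub : {x : Token d | (d : ℝ) / 20 ≤ (inner ℝ w x) ^ 2} ⊆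
      {x | √((d : ℝ) / 20) ≤ inner ℝ w x} ∪ {x | √((d : ℝ) / 20) ≤ inner ℝ (-w) x} := by
    intro x hx
    have := Real.sqrt_le_sqrt hx
    rw [Real.sqrt_sq_eq_abs] at this
    rcases le_abs.1 this with h | h
    · exact Or.inl h
    · exact Or.inr (by simpa using h)
  refine (measureReal_mono hsub).trans ((measureReal_union_le _ _).trans ?_)
  have := key w hw
  have := key (-w) (by simpa using hw)
  linarith

/-- Projecting removes two squared coordinates. Each is below `d/20` with high probability, and `3/5
- 2/20 = 1/2`. -/
lemma measureReal_noise_norm_sq_lt (hρ : 0 < ρ) (h₁ : ‖μ₁‖ = ρ) (h₂ : ‖μ₂‖ = ρ)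
    (h : inner ℝ μ₁ μ₂ = 0) :
    (multivariateGaussian 0 (noiseCov ρ μ₁ μ₂)).real {x | ‖x‖ ^ 2 < (d : ℝ) / 2} ≤
      5 * Real.exp (-(d : ℝ) / 50) := by
  rw [multivariateGaussian_noiseCov hρ h₁ h₂ h,
    map_measureReal_apply (by fun_prop) (measurableSet_lt (by fun_prop) (by fun_prop))]
  have hn : ∀ μ : Token d, ‖μ‖ = ρ → ‖ρ⁻¹ • μ‖ = 1 := by
    intro μ hμ
    rw [norm_smul, hμ, Real.norm_of_nonneg (by positivity), inv_mul_cancel₀ hρ.ne']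
  have hsub : noiseProj ρ μ₁ μ₂ ⁻¹' {x | ‖x‖ ^ 2 < (d : ℝ) / 2} ⊆
      {x | ‖x‖ ^ 2 ≤ 3 / 5 * (d : ℝ)} ∪ ({x | (d : ℝ) / 20 ≤ (inner ℝ (ρ⁻¹ • μ₁) x) ^ 2} ∪
        {x | (d : ℝ) / 20 ≤ (inner ℝ (ρ⁻¹ • μ₂) x) ^ 2}) := by
    intro x hx
    simp only [Set.mem_preimage, Set.mem_ofPred_eq, norm_sq_noiseProj hρ h₁ h₂ h] at hx
    simp only [Set.mem_union, Set.mem_ofPred_eq]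
    by_contra! hc
    linarith [hc.1, hc.2.1, hc.2.2]
  refine (measureReal_mono hsub).trans ((measureReal_union_le _ _).trans ?_)
  have h3 := measureReal_union_le (μ := stdGaussian (Token d))
    {x | (d : ℝ) / 20 ≤ (inner ℝ (ρ⁻¹ • μ₁) x) ^ 2} {x | (d : ℝ) / 20 ≤ (inner ℝ (ρ⁻¹ • μ₂) x) ^ 2}
  have := stdGaussian_inner_sq_ge (hn _ h₁)
  have := stdGaussian_inner_sq_ge (hn _ h₂)
  have := stdGaussian_norm_sq_le d
  linarith

end

/-! ### Marginal laws of a single draw -/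

instance : MeasurableSingletonClass Label where
  measurableSet_singleton y := by
    have : ({y} : Set Label) = Units.val ⁻¹' {(y : ℤ)} := by
      ext z
      simp [Units.ext_iff]
    rw [this]
    exact ⟨_, trivial, rfl⟩

lemma isProbabilityMeasure_flipLaw {η : ℝ} (h₀ : 0 ≤ η) (h₁ : η < 1 / 2) :
    IsProbabilityMeasure (flipLaw η) := by
  constructor
  simp only [flipLaw, Measure.coe_add, Measure.coe_smul, Pi.add_apply, Pi.smul_apply,
    measure_univ, smul_eq_mul, mul_one]
  rw [← ENNReal.ofReal_add (by linarith) h₀]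
  simp

lemma flipLaw_neg_one {η : ℝ} (h₀ : 0 ≤ η) : (flipLaw η).real {-1} = η := by
  simp only [flipLaw, Measure.real, Measure.coe_add, Measure.coe_smul, Pi.add_apply,
    Pi.smul_apply, smul_eq_mul, Measure.dirac_apply' _ (measurableSet_singleton (-1 : Label))]
  simp [ENNReal.toReal_ofReal h₀]

lemma uniform_label_ne (τ : Label) :
    (PMF.uniformOfFintype Label).toMeasure.real {l | l ≠ τ} = 1 / 2 := by
  have h : {l : Label | l ≠ τ} = {-τ} := by
    ext l
    simp only [Set.mem_ofPred_eq, Set.mem_singleton_iff, ne_eq]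
    rcases Int.units_eq_one_or l with rfl | rfl <;> rcases Int.units_eq_one_or τ with rfl | rfl <;>
      decide
  rw [h, Measure.real, PMF.toMeasure_apply_singleton _ _ (measurableSet_singleton _)]
  simp

section

variable {d : ℕ} {η ρ : ℝ} {μ₁ μ₂ : Token d}

lemma isProbabilityMeasure_drawLaw (h₀ : 0 ≤ η) (h₁ : η < 1 / 2) :
    IsProbabilityMeasure (drawLaw η ρ μ₁ μ₂) := by
  have := isProbabilityMeasure_flipLaw h₀ h₁
  unfold drawLaw
  infer_instance

lemma measurePreserving_cleanLabel (h₀ : 0 ≤ η) (h₁ : η < 1 / 2) :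
    MeasurePreserving Draw.cleanLabel (drawLaw η ρ μ₁ μ₂)
      (PMF.uniformOfFintype Label).toMeasure := by
  have := isProbabilityMeasure_flipLaw h₀ h₁
  exact measurePreserving_fst

lemma measurePreserving_flip (h₀ : 0 ≤ η) (h₁ : η < 1 / 2) :
    MeasurePreserving Draw.flip (drawLaw η ρ μ₁ μ₂) (flipLaw η) := by
  have := isProbabilityMeasure_flipLaw h₀ h₁
  exact measurePreserving_fst.comp measurePreserving_snd

lemma measurePreserving_noise (h₀ : 0 ≤ η) (h₁ : η < 1 / 2) :
    MeasurePreserving Draw.noise (drawLaw η ρ μ₁ μ₂)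
      (multivariateGaussian 0 (noiseCov ρ μ₁ μ₂)) := by
  have := isProbabilityMeasure_flipLaw h₀ h₁
  exact measurePreserving_snd.comp (measurePreserving_snd.comp measurePreserving_snd)

end

/-! ### Typical training sets -/

/-- Hoeffding's inequality for the number of samples that fall into a set. -/
lemma measureReal_card_ge_le {Ω : Type*} [MeasurableSpace Ω] (ν : Measure Ω)
    [IsProbabilityMeasure ν] (n : ℕ) {q : Ω → Prop} [DecidablePred q]
    (hA : MeasurableSet {x | q x}) {p t : ℝ} (hp : ν.real {x | q x} ≤ p) (ht : 0 ≤ t) :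
    (Measure.pi fun _ : Fin n => ν).real
      {ω | (p + t) * n ≤ (Finset.univ.filter fun i => q (ω i)).card} ≤
      Real.exp (-2 * t ^ 2 * n) := by
  set A : Set Ω := {x | q x} with hAdef
  set f : Ω → ℝ := A.indicator 1 with hf
  have hfm : Measurable f := measurable_one.indicator hA
  have hmean : ∫ x, f x ∂ν = ν.real A := integral_indicator_one hA
  have hsub : HasSubgaussianMGF (fun x => f x - ν.real A) ((‖(1 : ℝ) - 0‖₊ / 2) ^ 2) ν := by
    rw [← hmean]
    apply hasSubgaussianMGF_of_mem_Icc hfm.aemeasurable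
    refine Filter.Eventually.of_forall fun x => ?_
    by_cases hx : x ∈ A <;> simp [hf, hx]
  have hind : iIndepFun (fun (i : Fin n) (ω : Fin n → Ω) => f (ω i) - ν.real A)
      (Measure.pi fun _ : Fin n => ν) :=
    iIndepFun_pi (X := fun _ x => f x - ν.real A) fun _ => (hfm.sub_const _).aemeasurable
  have hsub' : ∀ i ∈ (Finset.univ : Finset (Fin n)),
      HasSubgaussianMGF (fun ω : Fin n → Ω => f (ω i) - ν.real A) ((‖(1 : ℝ) - 0‖₊ / 2) ^ 2)
        (Measure.pi fun _ : Fin n => ν) := by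
    intro i _
    have hmp := measurePreserving_eval (fun _ : Fin n => ν) i
    have hsub2 : HasSubgaussianMGF (fun x => f x - ν.real A) ((‖(1 : ℝ) - 0‖₊ / 2) ^ 2)
        ((Measure.pi fun _ : Fin n => ν).map (Function.eval i)) := by
      rw [hmp.map_eq]; exact hsub
    exact HasSubgaussianMGF.of_map hmp.measurable.aemeasurable hsub2
  have hmain := HasSubgaussianMGF.measure_sum_ge_le_of_iIndepFun hind hsub'
    (ε := t * n) (by positivity)
  have hle : {ω : Fin n → Ω | (p + t) * n ≤ (Finset.univ.filter fun i => q (ω i)).card} ⊆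
      {ω | t * n ≤ ∑ i, (f (ω i) - ν.real A)} := by
    intro ω hω
    simp only [Set.mem_ofPred_eq] at hω ⊢
    have hc : ∑ i, f (ω i) = (Finset.univ.filter fun i => q (ω i)).card := by
      simp [hf, hAdef, Set.indicator_apply]
    rw [Finset.sum_sub_distrib, hc]
    simp only [Finset.sum_const, Finset.card_univ, Fintype.card_fin, nsmul_eq_mul]
    have hn : (0 : ℝ) ≤ n := Nat.cast_nonneg n
    nlinarith [mul_le_mul_of_nonneg_right hp hn]
  refine (measureReal_mono hle).trans (hmain.trans (Real.exp_le_exp.2 (le_of_eq ?_)))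
  rcases Nat.eq_zero_or_pos n with rfl | hn
  · simp
  have hn' : (n : ℝ) ≠ 0 := by positivity
  simp
  field_simp

/-- The properties of the training draws on which the analysis of gradient descent rests. -/
structure IsGood {n d : ℕ} (ε : ℝ) (μ₁ μ₂ : Token d) (ω : Fin n → Draw d) : Prop where
  inner_noise₁ : ∀ i, inner ℝ μ₁ (ω i).noise = 0
  inner_noise₂ : ∀ i, inner ℝ μ₂ (ω i).noise = 0
  le_norm_sq : ∀ i, (d : ℝ) / 2 ≤ ‖(ω i).noise‖ ^ 2
  norm_sq_le : ∀ i, ‖(ω i).noise‖ ^ 2 ≤ 2 * (d : ℝ)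
  abs_inner_le : ∀ i j, i ≠ j → |inner ℝ (ω i).noise (ω j).noise| ≤ ε * d / n
  le_card_clean : ∀ τ : Label, (n : ℝ) / 4 ≤
    (Finset.univ.filter fun i => (ω i).cleanLabel = τ ∧ (ω i).flip = 1).card
  card_noisy_le : ((Finset.univ.filter fun i => (ω i).flip = -1).card : ℝ) ≤ ε * n

/-- The conditions on `n` and `d` make the failure probability of `IsGood` at most `δ`. -/
lemma failure_bound_le {d n : ℕ} {ε C δ : ℝ} (hε : 0 < ε) (hε' : ε ≤ 1 / 12) (hδ : 0 < δ)
    (hδ' : δ < 1 / 2) (hC : 32 / ε ^ 2 ≤ C) (hn0 : 0 < n) (hd0 : 0 < d)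
    (hn : C * Real.log (1 / δ) ≤ n) (hd : C * (n : ℝ) ^ 2 * Real.log (n / δ) ≤ d) :
    2 * Real.exp (-(n : ℝ) / 18) + Real.exp (-(ε ^ 2 * n) / 2) +
        n * (6 * Real.exp (-(d : ℝ) / 50)) +
        n * (n * (2 * Real.exp (-(ε * d / n) ^ 2 / (2 * (2 * d))))) ≤ δ := by
  have hn1 : (1 : ℝ) ≤ n := by exact_mod_cast hn0
  have hd1 : (0 : ℝ) < d := by exact_mod_cast hd0
  have hCε : 32 ≤ C * ε ^ 2 := by rwa [div_le_iff₀ (by positivity)] at hC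
  have hlog : 0 < Real.log (1 / δ) := Real.log_pos (by rw [lt_div_iff₀ hδ]; linarith)
  have hlogn : Real.log (1 / δ) ≤ Real.log (n / δ) :=
    Real.log_le_log (by positivity) (by gcongr)
  have hCpos : 0 < C := lt_of_lt_of_le (by positivity) hC
  have hεsq : ε ^ 2 ≤ 1 / 144 := by nlinarith
  have hCbig : 144 * 32 ≤ C := by nlinarith
  -- Each exponential is bounded by an eighth power. This absorbs the factors `n` and `n²` of the
  -- union bounds and leaves `11 δ ^ 8 ≤ δ`. The cross-term bound `b4` is what requires `C ≥ 32 /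
  -- ε²`.
  have hδ8 : Real.exp (-(8 * Real.log (1 / δ))) = δ ^ 8 := by
    rw [one_div, Real.log_inv, mul_neg, neg_neg]
    have := Real.exp_nat_mul (Real.log δ) 8
    rw [Real.exp_log hδ] at this
    exact_mod_cast this
  have hδn8 : Real.exp (-(8 * Real.log (n / δ))) = (δ / n) ^ 8 := by
    rw [← inv_div, Real.log_inv, mul_neg, neg_neg]
    have := Real.exp_nat_mul (Real.log (δ / n)) 8
    rw [Real.exp_log (by positivity)] at this
    exact_mod_cast this
  have b1 : Real.exp (-(n : ℝ) / 18) ≤ δ ^ 8 := by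
    rw [← hδ8]; apply Real.exp_le_exp.2; nlinarith
  have b2 : Real.exp (-(ε ^ 2 * n) / 2) ≤ δ ^ 8 := by
    rw [← hδ8]; apply Real.exp_le_exp.2
    have : ε ^ 2 * (C * Real.log (1 / δ)) ≤ ε ^ 2 * n := by gcongr
    nlinarith
  have b3 : Real.exp (-(d : ℝ) / 50) ≤ (δ / n) ^ 8 := by
    rw [← hδn8]; apply Real.exp_le_exp.2
    have h1 : C * 1 * Real.log (n / δ) ≤ C * (n : ℝ) ^ 2 * Real.log (n / δ) := by
      have : (1 : ℝ) ≤ (n : ℝ) ^ 2 := one_le_pow₀ hn1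
      gcongr
      linarith
    nlinarith
  have b4 : Real.exp (-(ε * d / n) ^ 2 / (2 * (2 * d))) ≤ (δ / n) ^ 8 := by
    rw [← hδn8]; apply Real.exp_le_exp.2
    have e : -(ε * d / n) ^ 2 / (2 * (2 * d)) = -(ε ^ 2 * (d / n ^ 2) / 4) := by
      field_simp
      norm_num
    rw [e]
    have h1 : C * Real.log (n / δ) ≤ d / n ^ 2 := by
      rw [le_div_iff₀ (by positivity)]; linarith
    have h2 : ε ^ 2 * (C * Real.log (n / δ)) ≤ ε ^ 2 * (d / n ^ 2) := by gcongr
    nlinarith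
  have hquot : n * (n * (δ / n) ^ 8) ≤ δ ^ 8 := by
    rw [div_pow, ← mul_assoc, ← mul_div_assoc, div_le_iff₀ (by positivity)]
    have : (n : ℝ) * n ≤ (n : ℝ) ^ 8 := by
      rw [← sq]; exact pow_le_pow_right₀ hn1 (by norm_num)
    rw [mul_comm (δ ^ 8)]
    gcongr
  have hq0 : 0 ≤ (δ / n) ^ 8 := by positivity
  have hquot1 : n * (δ / n) ^ 8 ≤ δ ^ 8 := by
    refine le_trans ?_ hquot
    have : (δ / n) ^ 8 ≤ n * (δ / n) ^ 8 := le_mul_of_one_le_left hq0 hn1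
    gcongr
  have h3 : (n : ℝ) * (6 * Real.exp (-(d : ℝ) / 50)) ≤ 6 * δ ^ 8 := by
    have : (n : ℝ) * Real.exp (-(d : ℝ) / 50) ≤ n * (δ / n) ^ 8 := by gcongr
    linarith
  have h4 : n * (n * (2 * Real.exp (-(ε * d / n) ^ 2 / (2 * (2 * d))))) ≤ 2 * δ ^ 8 := by
    have : n * (n * Real.exp (-(ε * d / n) ^ 2 / (2 * (2 * d)))) ≤ n * (n * (δ / n) ^ 8) := by
      gcongr
    linarith
  have h5 : δ ^ 8 ≤ δ / 128 := by
    have : δ ^ 7 ≤ (1 / 2) ^ 7 := by gcongr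
    calc δ ^ 8 = δ * δ ^ 7 := by ring
      _ ≤ δ * (1 / 2) ^ 7 := by gcongr
      _ = δ / 128 := by ring
  linarith

section

variable {d n : ℕ} {η ρ ε : ℝ} {μ₁ μ₂ : Token d}

/-- The two noise vectors are independent. With `ξ_j` fixed, the inner product is Gaussian of
variance at most `‖ξ_j‖²`, which the norm condition inside the event caps at `2 d`; Fubini then
integrates the tail bound. -/
lemma measureReal_inner_noise_pair (h₀ : 0 ≤ η) (hη : η < 1 / 2) (hρ : 0 < ρ) (h₁ : ‖μ₁‖ = ρ)
    (h₂ : ‖μ₂‖ = ρ) (h : inner ℝ μ₁ μ₂ = 0) (hd : 0 < d) {i j : Fin n} (hij : i ≠ j) {s : ℝ}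
    (hs : 0 ≤ s) :
    (trainLaw n η ρ μ₁ μ₂).real {ω | ‖(ω j).noise‖ ^ 2 ≤ 2 * (d : ℝ) ∧
      s ≤ |inner ℝ (ω i).noise (ω j).noise|} ≤ 2 * Real.exp (-s ^ 2 / (2 * (2 * d))) := by
  have := isProbabilityMeasure_drawLaw (ρ := ρ) (μ₁ := μ₁) (μ₂ := μ₂) h₀ hη
  set γ := multivariateGaussian 0 (noiseCov ρ μ₁ μ₂) with hγ
  have hnm : Measurable (Draw.noise : Draw d → Token d) :=
    (measurePreserving_noise (ρ := ρ) (μ₁ := μ₁) (μ₂ := μ₂) h₀ hη).measurable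
  have hlaw : ∀ k : Fin n, (trainLaw n η ρ μ₁ μ₂).map (fun ω => (ω k).noise) = γ := fun k =>
    ((measurePreserving_noise h₀ hη).comp (measurePreserving_eval _ k)).map_eq
  have hpair : (trainLaw n η ρ μ₁ μ₂).map (fun ω => ((ω i).noise, (ω j).noise)) = γ.prod γ := by
    have hind : iIndepFun (fun (k : Fin n) (ω : Fin n → Draw d) => (ω k).noise)
        (trainLaw n η ρ μ₁ μ₂) := iIndepFun_pi (X := fun _ => Draw.noise) fun _ => hnm.aemeasurable
    have hm : ∀ k : Fin n, Measurable fun ω : Fin n → Draw d => (ω k).noise := fun k =>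
      hnm.comp (measurable_pi_apply k)
    have hprob : IsProbabilityMeasure (trainLaw n η ρ μ₁ μ₂) := by
      unfold trainLaw; infer_instance
    rw [(indepFun_iff_map_prod_eq_prod_map_map (hm i).aemeasurable (hm j).aemeasurable).1
      (hind.indepFun hij), hlaw, hlaw]
  set B : Set (Token d × Token d) := {z | ‖z.2‖ ^ 2 ≤ 2 * (d : ℝ) ∧ s ≤ |inner ℝ z.1 z.2|}
  have hB : MeasurableSet B := by
    have hB₁ : MeasurableSet {z : Token d × Token d | ‖z.2‖ ^ 2 ≤ 2 * (d : ℝ)} :=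
      measurableSet_le (by fun_prop) (by fun_prop)
    have hB₂ : MeasurableSet {z : Token d × Token d | s ≤ |inner ℝ z.1 z.2|} :=
      measurableSet_le (by fun_prop) (continuous_fst.inner continuous_snd).abs.measurable
    exact hB₁.inter hB₂
  have hset : {ω : Fin n → Draw d | ‖(ω j).noise‖ ^ 2 ≤ 2 * (d : ℝ) ∧
      s ≤ |inner ℝ (ω i).noise (ω j).noise|} =
      (fun ω : Fin n → Draw d => ((ω i).noise, (ω j).noise)) ⁻¹' B := rfl
  have hm2 : Measurable fun ω : Fin n → Draw d => ((ω i).noise, (ω j).noise) :=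
    (hnm.comp (measurable_pi_apply i)).prodMk (hnm.comp (measurable_pi_apply j))
  rw [hset, ← map_measureReal_apply hm2 hB, hpair, Measure.real, Measure.prod_apply_symm hB]
  set b := 2 * Real.exp (-s ^ 2 / (2 * (2 * d))) with hb
  have hbound : ∀ y : Token d, γ ((fun x => (x, y)) ⁻¹' B) ≤ ENNReal.ofReal b := by
    intro y
    by_cases hy : ‖y‖ ^ 2 ≤ 2 * (d : ℝ)
    · have hw : ∀ w : Token d, ‖w‖ = ‖y‖ → γ.real {x | s ≤ inner ℝ w x} ≤
          Real.exp (-s ^ 2 / (2 * (2 * d))) := by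
        intro w hw
        refine measureReal_inner_noise_ge hρ h₁ h₂ h w (by positivity) hs ?_
        rw [norm_sq_noiseProj hρ h₁ h₂ h, hw]
        nlinarith [sq_nonneg (inner ℝ (ρ⁻¹ • μ₁) w), sq_nonneg (inner ℝ (ρ⁻¹ • μ₂) w)]
      have hsub : (fun x => (x, y)) ⁻¹' B ⊆ {x | s ≤ inner ℝ y x} ∪ {x | s ≤ inner ℝ (-y) x} := by
        intro x hx
        rcases le_abs.1 hx.2 with h | h
        · exact Or.inl (by simpa [real_inner_comm] using h)
        · exact Or.inr (by simpa [real_inner_comm] using h)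
      have := (measureReal_mono (μ := γ) hsub).trans (measureReal_union_le _ _)
      have e1 := hw y rfl
      have e2 := hw (-y) (norm_neg y)
      rw [← ENNReal.ofReal_toReal (measure_ne_top γ ((fun x => (x, y)) ⁻¹' B))]
      apply ENNReal.ofReal_le_ofReal
      change γ.real _ ≤ b
      linarith
    · have : (fun x => (x, y)) ⁻¹' B = ∅ := by
        ext x
        simp [B, hy]
      rw [this]
      simp
  apply ENNReal.toReal_le_of_le_ofReal (by positivity)
  calc ∫⁻ y, γ ((fun x => (x, y)) ⁻¹' B) ∂γ ≤ ∫⁻ _, ENNReal.ofReal b ∂γ :=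
        lintegral_mono hbound
    _ = ENNReal.ofReal b := by simp

/-- The failure probability of `IsGood`, before the conditions on `n` and `d` are used. -/
lemma measureReal_not_isGood_le (h₀ : 0 ≤ η) (hη : η < 1 / 2) (hρ : 0 < ρ) (h₁ : ‖μ₁‖ = ρ)
    (h₂ : ‖μ₂‖ = ρ) (h : inner ℝ μ₁ μ₂ = 0) (hd : 0 < d) (hε : 0 < ε) (hε' : ε ≤ 1 / 12)
    (hηε : η ≤ ε / 2) :
    (trainLaw n η ρ μ₁ μ₂).real {ω | IsGood ε μ₁ μ₂ ω}ᶜ ≤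
      2 * Real.exp (-(n : ℝ) / 18) + Real.exp (-(ε ^ 2 * n) / 2) +
        n * (6 * Real.exp (-(d : ℝ) / 50)) +
        n * (n * (2 * Real.exp (-(ε * d / n) ^ 2 / (2 * (2 * d))))) := by
  have := isProbabilityMeasure_drawLaw (ρ := ρ) (μ₁ := μ₁) (μ₂ := μ₂) h₀ hη
  set P := trainLaw n η ρ μ₁ μ₂ with hP
  have hprob : IsProbabilityMeasure P := by
    rw [hP]; unfold trainLaw; infer_instance
  set γ := multivariateGaussian 0 (noiseCov ρ μ₁ μ₂) with hγ
  have hnoise : ∀ i : Fin n, MeasurePreserving (fun ω : Fin n → Draw d => (ω i).noise) P γ :=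
    fun i => (measurePreserving_noise h₀ hη).comp (measurePreserving_eval _ i)
  -- Outside these events at most `2/3` of the samples have the other clean label and at most `ε ≤
  -- 1/12` are flipped, which leaves at least `1/4` clean in each class.
  set L : Label → Set (Fin n → Draw d) := fun τ =>
    {ω | (1 / 2 + 1 / 6 : ℝ) * n ≤ (Finset.univ.filter fun i => (ω i).cleanLabel ≠ τ).card} with hLdef
  set N : Set (Fin n → Draw d) :=
    {ω | (ε / 2 + ε / 2 : ℝ) * n ≤ (Finset.univ.filter fun i => (ω i).flip = -1).card} with hNdef
  set O : Fin n → Set (Fin n → Draw d) := fun i =>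
    (fun ω => (ω i).noise) ⁻¹' {x | ¬ (inner ℝ μ₁ x = 0 ∧ inner ℝ μ₂ x = 0)}
  set U : Fin n → Set (Fin n → Draw d) := fun i =>
    (fun ω => (ω i).noise) ⁻¹' {x | 2 * (d : ℝ) < ‖x‖ ^ 2}
  set W : Fin n → Set (Fin n → Draw d) := fun i =>
    (fun ω => (ω i).noise) ⁻¹' {x | ‖x‖ ^ 2 < (d : ℝ) / 2}
  set X : Fin n → Fin n → Set (Fin n → Draw d) := fun i j =>
    {ω | i ≠ j ∧ ‖(ω j).noise‖ ^ 2 ≤ 2 * (d : ℝ) ∧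
      ε * d / n ≤ |inner ℝ (ω i).noise (ω j).noise|}
  have hsub : {ω | IsGood ε μ₁ μ₂ ω}ᶜ ⊆
      L 1 ∪ L (-1) ∪ N ∪ (⋃ i, O i ∪ U i ∪ W i) ∪ ⋃ i, ⋃ j, X i j := by
    intro ω hω
    by_contra hc
    apply hω
    simp only [Set.mem_union, Set.mem_iUnion, not_or, not_exists] at hc
    obtain ⟨⟨⟨⟨hL1, hL2⟩, hN⟩, hO⟩, hX⟩ := hc
    have hL : ∀ τ, ω ∉ L τ := by
      intro τ
      rcases Int.units_eq_one_or τ with rfl | rfl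
      · exact hL1
      · exact hL2
    have hN' : ((Finset.univ.filter fun i => (ω i).flip = -1).card : ℝ) ≤ ε * n := by
      simp only [hNdef, Set.mem_ofPred_eq, not_le] at hN
      linarith
    have hnorm : ∀ i, ‖(ω i).noise‖ ^ 2 ≤ 2 * (d : ℝ) := fun i => not_lt.1 (hO i).1.2
    refine ⟨fun i => (not_not.1 (hO i).1.1).1, fun i => (not_not.1 (hO i).1.1).2,
      fun i => not_lt.1 (hO i).2, hnorm, ?_, ?_, hN'⟩
    · intro i j hij
      by_contra hlt
      exact hX i j ⟨hij, hnorm j, (not_le.1 hlt).le⟩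
    · intro τ
      have h3 := hL τ
      simp only [hLdef, Set.mem_ofPred_eq, not_le] at h3
      have hcover : (Finset.univ : Finset (Fin n)) ⊆
          (Finset.univ.filter fun i => (ω i).cleanLabel = τ ∧ (ω i).flip = 1) ∪
          ((Finset.univ.filter fun i => (ω i).cleanLabel ≠ τ) ∪
            (Finset.univ.filter fun i => (ω i).flip = -1)) := by
        intro i _
        simp only [Finset.mem_union, Finset.mem_filter, Finset.mem_univ, true_and]
        by_cases hi : (ω i).cleanLabel = τ
        · rcases Int.units_eq_one_or (ω i).flip with hf | hf <;> simp [hi, hf]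
        · simp [hi]
      have hcard := (Finset.card_le_card hcover).trans ((Finset.card_union_le _ _).trans
        (Nat.add_le_add_left (Finset.card_union_le _ _) _))
      rw [Finset.card_univ, Fintype.card_fin] at hcard
      have hcard' : (n : ℝ) ≤
          ((Finset.univ.filter fun i => (ω i).cleanLabel = τ ∧ (ω i).flip = 1).card : ℝ) +
          (((Finset.univ.filter fun i => (ω i).cleanLabel ≠ τ).card : ℝ) +
            ((Finset.univ.filter fun i => (ω i).flip = -1).card : ℝ)) := by
        exact_mod_cast hcard
      have hn : (0 : ℝ) ≤ n := Nat.cast_nonneg n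
      nlinarith
  have hLb : ∀ τ, P.real (L τ) ≤ Real.exp (-(n : ℝ) / 18) := by
    intro τ
    have hmp := measurePreserving_cleanLabel (ρ := ρ) (μ₁ := μ₁) (μ₂ := μ₂) h₀ hη
    have hms : MeasurableSet {l : Label | l ≠ τ} := Set.Finite.measurableSet (Set.toFinite _)
    have hp : (drawLaw η ρ μ₁ μ₂).real (Draw.cleanLabel ⁻¹' {l : Label | l ≠ τ}) ≤ 1 / 2 := by
      rw [hmp.measureReal_preimage hms.nullMeasurableSet, uniform_label_ne]
    refine (measureReal_card_ge_le (drawLaw η ρ μ₁ μ₂) n (hmp.measurable hms) hp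
      (by norm_num : (0 : ℝ) ≤ 1 / 6)).trans (Real.exp_le_exp.2 (le_of_eq ?_))
    norm_num
    ring
  have hNb : P.real N ≤ Real.exp (-(ε ^ 2 * n) / 2) := by
    have hmp := measurePreserving_flip (ρ := ρ) (μ₁ := μ₁) (μ₂ := μ₂) h₀ hη
    have hms : MeasurableSet ({-1} : Set Label) := measurableSet_singleton _
    have hp : (drawLaw η ρ μ₁ μ₂).real (Draw.flip ⁻¹' {-1}) ≤ ε / 2 := by
      rw [hmp.measureReal_preimage hms.nullMeasurableSet, flipLaw_neg_one h₀]
      exact hηε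
    refine (measureReal_card_ge_le (drawLaw η ρ μ₁ μ₂) n (hmp.measurable hms) hp
      (by positivity : (0 : ℝ) ≤ ε / 2)).trans (Real.exp_le_exp.2 (le_of_eq ?_))
    ring
  have hOb : ∀ i, P.real (O i ∪ U i ∪ W i) ≤ 6 * Real.exp (-(d : ℝ) / 50) := by
    intro i
    have hO0 : P.real (O i) = 0 := by
      have hms : MeasurableSet {x : Token d | ¬ (inner ℝ μ₁ x = 0 ∧ inner ℝ μ₂ x = 0)} :=
        ((measurableSet_eq_fun (by fun_prop) (by fun_prop)).inter
          (measurableSet_eq_fun (by fun_prop) (by fun_prop))).compl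
      rw [(hnoise i).measureReal_preimage hms.nullMeasurableSet, Measure.real,
        ae_iff.1 (ae_noise_orthogonal hρ h₁ h₂ h)]
      simp
    have hU : P.real (U i) ≤ Real.exp (-(d : ℝ) / 50) := by
      rw [(hnoise i).measureReal_preimage
        (measurableSet_lt (by fun_prop) (by fun_prop)).nullMeasurableSet]
      exact measureReal_noise_norm_sq_gt hρ h₁ h₂ h
    have hW : P.real (W i) ≤ 5 * Real.exp (-(d : ℝ) / 50) := by
      rw [(hnoise i).measureReal_preimage
        (measurableSet_lt (by fun_prop) (by fun_prop)).nullMeasurableSet]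
      exact measureReal_noise_norm_sq_lt hρ h₁ h₂ h
    have e1 := measureReal_union_le (μ := P) (O i ∪ U i) (W i)
    have e2 := measureReal_union_le (μ := P) (O i) (U i)
    linarith
  have hXb : ∀ i j, P.real (X i j) ≤ 2 * Real.exp (-(ε * d / n) ^ 2 / (2 * (2 * d))) := by
    intro i j
    by_cases hij : i = j
    · have : X i j = ∅ := by
        ext ω
        simp [X, hij]
      rw [this]
      simp only [measureReal_empty]
      positivity
    · refine (measureReal_mono ?_).trans (measureReal_inner_noise_pair h₀ hη hρ h₁ h₂ h hd hij
        (by positivity))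
      exact fun ω hω => hω.2
  have hsum : ∀ {A : Fin n → Set (Fin n → Draw d)} {b : ℝ}, (∀ i, P.real (A i) ≤ b) →
      P.real (⋃ i, A i) ≤ n * b := by
    intro A b hA
    refine (measureReal_iUnion_fintype_le _).trans ((Finset.sum_le_sum fun i _ => hA i).trans ?_)
    simp
  refine (measureReal_mono hsub).trans ?_
  have e1 := measureReal_union_le (μ := P) (L 1 ∪ L (-1) ∪ N ∪ (⋃ i, O i ∪ U i ∪ W i))
    (⋃ i, ⋃ j, X i j)
  have e2 := measureReal_union_le (μ := P) (L 1 ∪ L (-1) ∪ N) (⋃ i, O i ∪ U i ∪ W i)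
  have e3 := measureReal_union_le (μ := P) (L 1 ∪ L (-1)) N
  have e4 := measureReal_union_le (μ := P) (L 1) (L (-1))
  have e5 := hsum hOb
  have e6 := hsum fun i => hsum (hXb i)
  have e7 := hLb 1
  have e8 := hLb (-1)
  linarith

lemma measureReal_isGood_ge {C δ : ℝ} (h₀ : 0 ≤ η) (hη : η < 1 / 2) (hρ : 0 < ρ) (h₁ : ‖μ₁‖ = ρ)
    (h₂ : ‖μ₂‖ = ρ) (h : inner ℝ μ₁ μ₂ = 0) (hε : 0 < ε) (hε' : ε ≤ 1 / 12)
    (hηε : η ≤ ε / 2) (hδ : 0 < δ) (hδ' : δ < 1 / 2) (hC : 32 / ε ^ 2 ≤ C) (hn0 : 0 < n)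
    (hd0 : 0 < d) (hn : C * Real.log (1 / δ) ≤ n) (hd : C * (n : ℝ) ^ 2 * Real.log (n / δ) ≤ d) :
    1 - δ ≤ (trainLaw n η ρ μ₁ μ₂).real {ω | IsGood ε μ₁ μ₂ ω} := by
  have := isProbabilityMeasure_drawLaw (ρ := ρ) (μ₁ := μ₁) (μ₂ := μ₂) h₀ hη
  set P := trainLaw n η ρ μ₁ μ₂ with hP
  have hprob : IsProbabilityMeasure P := by
    rw [hP]; unfold trainLaw; infer_instance
  have hbad := measureReal_not_isGood_le (n := n) h₀ hη hρ h₁ h₂ h hd0 hε hε' hηε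
  -- Subadditivity is enough here, so measurability of the good event is not needed.
  have htot : (1 : ℝ) ≤ P.real {ω | IsGood ε μ₁ μ₂ ω} + P.real {ω | IsGood ε μ₁ μ₂ ω}ᶜ := by
    have := measureReal_union_le (μ := P) {ω | IsGood ε μ₁ μ₂ ω} {ω | IsGood ε μ₁ μ₂ ω}ᶜ
    rwa [Set.union_compl_self, probReal_univ] at this
  have := failure_bound_le hε hε' hδ hδ' hC hn0 hd0 hn hd
  linarith

end

/-! ### Gradients and closed forms of the first two iterates -/

lemma hasDerivAt_logisticLoss (z : ℝ) :
    HasDerivAt logisticLoss (-(1 + Real.exp z)⁻¹) z := by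
  have h1 : HasDerivAt (fun z : ℝ => 1 + Real.exp (-z)) (Real.exp (-z) * (-1)) z :=
    ((hasDerivAt_neg z).exp).const_add 1
  refine (h1.log (by positivity)).congr_deriv ?_
  rw [Real.exp_neg]
  field_simp
  ring

lemma gradient_average_logisticLoss {d n : ℕ} (y : Fin n → ℝ) (F : Fin n → Token d → ℝ)
    (G : Fin n → Token d) (w : Token d) (hF : ∀ i, HasGradientAt (F i) (G i) w) :
    gradient (fun w => (1 / (n : ℝ)) * ∑ i, logisticLoss (y i * F i w)) w =
      -((1 / (n : ℝ)) • ∑ i, ((1 + Real.exp (y i * F i w))⁻¹ * y i) • G i) := by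
  apply HasGradientAt.gradient
  rw [hasGradientAt_iff_hasFDerivAt]
  have h : ∀ i, HasFDerivAt (fun w => logisticLoss (y i * F i w))
      (-(1 + Real.exp (y i * F i w))⁻¹ • y i • (InnerProductSpace.toDual ℝ (Token d)) (G i)) w :=
    fun i => (hasDerivAt_logisticLoss _).comp_hasFDerivAt w
      ((hasGradientAt_iff_hasFDerivAt.1 (hF i)).const_mul (y i))
  have h2 := (HasFDerivAt.fun_sum (u := Finset.univ) fun i _ => h i).const_mul (1 / (n : ℝ))
  refine h2.congr_fderiv ?_
  ext x
  simp [Finset.mul_sum, mul_assoc]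

lemma attn_eq {d : ℕ} (X : Input d) (p : Token d) {j k : Fin 2} (hjk : j ≠ k) :
    attn X p j = (1 + Real.exp (inner ℝ (X k) p - inner ℝ (X j) p))⁻¹ := by
  have hs : ∑ l, Real.exp (inner ℝ (X l) p) =
      Real.exp (inner ℝ (X j) p) + Real.exp (inner ℝ (X k) p) := by
    fin_cases j <;> fin_cases k <;> simp_all [Fin.sum_univ_two, add_comm]
  rw [attn, softmax, hs, Real.exp_sub]
  field_simp

lemma model_eq {d : ℕ} (v p : Token d) (X : Input d) {j k : Fin 2} (hjk : j ≠ k) :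
    model v p X = attn X p j * inner ℝ v (X j) + attn X p k * inner ℝ v (X k) := by
  rw [model, inner_sum]
  fin_cases j <;> fin_cases k <;>
    simp_all [Fin.sum_univ_two, add_comm, real_inner_smul_right]

lemma hasGradientAt_model_left {d : ℕ} (v p : Token d) (X : Input d) :
    HasGradientAt (fun v => model v p X) (∑ j, attn X p j • X j) v := by
  have hf : (fun v => model v p X) =
      (InnerProductSpace.toDual ℝ (Token d)) (∑ j, attn X p j • X j) := by
    ext v
    rw [model, InnerProductSpace.toDual_apply_apply, real_inner_comm]
  rw [hasGradientAt_iff_hasFDerivAt, hf]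
  exact ContinuousLinearMap.hasFDerivAt _

lemma attn_zero {d : ℕ} (X : Input d) (j : Fin 2) : attn X 0 j = 1 / 2 := by
  simp [attn, softmax]

/-- With two tokens the model is a sigmoid of `⟨x₀ - x₁, p⟩`, and the sigmoid has slope `1/4` at
`0`. As `p₀ = p₁ = 0`, no other point is needed for two steps. -/
lemma hasGradientAt_model_right_zero {d : ℕ} (v : Token d) (X : Input d) :
    HasGradientAt (fun p => model v p X) ((1 / 4 * inner ℝ v (X 0 - X 1)) • (X 0 - X 1)) 0 := by
  have hf : (fun p => model v p X) = fun p => inner ℝ v (X 1) +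
      inner ℝ v (X 0 - X 1) * (1 + Real.exp (-(InnerProductSpace.toDual ℝ (Token d) (X 0 - X 1)) p))⁻¹ := by
    ext p
    have e : Real.exp (inner ℝ (X 0) p - inner ℝ (X 1) p) *
        Real.exp (inner ℝ (X 1) p - inner ℝ (X 0) p) = 1 := by
      rw [← Real.exp_add]; simp
    rw [model_eq v p X (j := 0) (k := 1) (by decide), attn_eq X p (j := 0) (k := 1) (by decide),
      attn_eq X p (j := 1) (k := 0) (by decide), InnerProductSpace.toDual_apply_apply,
      inner_sub_left, inner_sub_right, neg_sub]
    have := Real.exp_pos (inner ℝ (X 0) p - inner ℝ (X 1) p)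
    have := Real.exp_pos (inner ℝ (X 1) p - inner ℝ (X 0) p)
    field_simp
    linear_combination (- inner ℝ v (X 1)) * e
  rw [hf, hasGradientAt_iff_hasFDerivAt]
  have hσ : HasDerivAt (fun z : ℝ => (1 + Real.exp (-z))⁻¹) (1 / 4) 0 := by
    have h1 : HasDerivAt (fun z : ℝ => 1 + Real.exp (-z)) (Real.exp (-0) * (-1)) 0 :=
      ((hasDerivAt_neg 0).exp).const_add 1
    refine (h1.fun_inv (by positivity)).congr_deriv ?_
    norm_num
  have hL := (InnerProductSpace.toDual ℝ (Token d) (X 0 - X 1)).hasFDerivAt (x := 0)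
  rw [← map_zero (InnerProductSpace.toDual ℝ (Token d) (X 0 - X 1))] at hσ
  have := ((hσ.comp_hasFDerivAt (0 : Token d) hL).const_mul (inner ℝ v (X 0 - X 1))).const_add
    (inner ℝ v (X 1))
  refine this.congr_fderiv ?_
  ext x
  simp
  ring

section

variable {d n : ℕ}

lemma Draw.input_pos (μ₁ μ₂ : Token d) (ω : Draw d) : ω.input μ₁ μ₂ ω.pos = ω.signal μ₁ μ₂ := by
  simp [Draw.input]

lemma Draw.noisePos_ne_pos (ω : Draw d) : ω.noisePos ≠ ω.pos := by
  rw [Draw.noisePos]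
  generalize ω.pos = k
  fin_cases k <;> decide

lemma Draw.input_noisePos (μ₁ μ₂ : Token d) (ω : Draw d) :
    ω.input μ₁ μ₂ ω.noisePos = ω.noise := by
  simp [Draw.input, ω.noisePos_ne_pos]

lemma Draw.input_add (μ₁ μ₂ : Token d) (ω : Draw d) :
    ω.input μ₁ μ₂ 0 + ω.input μ₁ μ₂ 1 = ω.signal μ₁ μ₂ + ω.noise := by
  have : ω.pos = 0 ∨ ω.pos = 1 := by
    generalize ω.pos = k
    fin_cases k <;> simp
  rcases this with h | h <;> simp [Draw.input, h, add_comm]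

/-- The expression is quadratic in the token difference, so the random position of the signal drops
out. -/
lemma Draw.inner_smul_input_sub (μ₁ μ₂ v : Token d) (ω : Draw d) :
    (1 / 4 * inner ℝ v (ω.input μ₁ μ₂ 0 - ω.input μ₁ μ₂ 1)) •
      (ω.input μ₁ μ₂ 0 - ω.input μ₁ μ₂ 1) =
    (1 / 4 * inner ℝ v (ω.signal μ₁ μ₂ - ω.noise)) • (ω.signal μ₁ μ₂ - ω.noise) := by
  have : ω.pos = 0 ∨ ω.pos = 1 := by
    generalize ω.pos = k
    fin_cases k <;> simp
  rcases this with h | h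
  · simp [Draw.input, h]
  · rw [← neg_sub (ω.input μ₁ μ₂ 1), inner_neg_right, mul_neg, neg_smul, smul_neg, neg_neg]
    simp [Draw.input, h]

/-- The observed label as a real number. -/
noncomputable def Draw.y (ω : Draw d) : ℝ := ω.label.toReal

/-- The value vector after one step of gradient descent. -/
noncomputable def firstV (β : ℝ) (μ₁ μ₂ : Token d) (ω : Fin n → Draw d) : Token d :=
  (β / (4 * n)) • ∑ i, (ω i).y • ((ω i).signal μ₁ μ₂ + (ω i).noise)

/-- The negative derivative of the loss on sample `i` after one step of gradient descent. -/
noncomputable def lossWeight (β : ℝ) (μ₁ μ₂ : Token d) (ω : Fin n → Draw d) (i : Fin n) : ℝ :=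
  (1 + Real.exp ((ω i).y *
    (inner ℝ (firstV β μ₁ μ₂ ω) ((ω i).signal μ₁ μ₂ + (ω i).noise) / 2)))⁻¹

lemma sum_attn_zero (μ₁ μ₂ : Token d) (ω : Draw d) :
    ∑ j, attn (ω.input μ₁ μ₂) 0 j • ω.input μ₁ μ₂ j =
      (1 / 2 : ℝ) • (ω.signal μ₁ μ₂ + ω.noise) := by
  simp_rw [attn_zero]
  rw [Fin.sum_univ_two, ← smul_add, ω.input_add]

lemma model_right_zero (μ₁ μ₂ v : Token d) (ω : Draw d) :
    model v 0 (ω.input μ₁ μ₂) = inner ℝ v (ω.signal μ₁ μ₂ + ω.noise) / 2 := by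
  rw [model, sum_attn_zero, real_inner_smul_right]
  ring

lemma gradient_risk_left (μ₁ μ₂ v : Token d) (ω : Fin n → Draw d) :
    gradient (fun v' => risk (trainSet μ₁ μ₂ ω) v' 0) v =
      -((1 / (n : ℝ)) • ∑ i, ((1 + Real.exp ((ω i).y *
        (inner ℝ v ((ω i).signal μ₁ μ₂ + (ω i).noise) / 2)))⁻¹ * (ω i).y) •
          (1 / 2 : ℝ) • ((ω i).signal μ₁ μ₂ + (ω i).noise)) := by
  have := gradient_average_logisticLoss (fun i => (ω i).y)
    (fun i v => model v 0 ((ω i).input μ₁ μ₂)) _ v fun i => hasGradientAt_model_left v 0 _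
  simp_rw [sum_attn_zero, model_right_zero] at this
  rw [← this]
  simp only [risk, trainSet, Draw.dataPoint, Draw.y, model_right_zero]

lemma gradient_risk_right_zero (μ₁ μ₂ v : Token d) (ω : Fin n → Draw d) :
    gradient (fun p' => risk (trainSet μ₁ μ₂ ω) v p') 0 =
      -((1 / (n : ℝ)) • ∑ i, ((1 + Real.exp ((ω i).y *
        (inner ℝ v ((ω i).signal μ₁ μ₂ + (ω i).noise) / 2)))⁻¹ * (ω i).y) •
          (1 / 4 * inner ℝ v ((ω i).signal μ₁ μ₂ - (ω i).noise)) •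
            ((ω i).signal μ₁ μ₂ - (ω i).noise)) := by
  have := gradient_average_logisticLoss (fun i => (ω i).y)
    (fun i p => model v p ((ω i).input μ₁ μ₂)) _ 0 fun i => hasGradientAt_model_right_zero v _
  simp_rw [Draw.inner_smul_input_sub, model_right_zero] at this
  rw [← this]
  simp only [risk, trainSet, Draw.dataPoint, Draw.y]

lemma gd_one (β : ℝ) (μ₁ μ₂ : Token d) (ω : Fin n → Draw d) :
    gd (trainSet μ₁ μ₂ ω) β 1 = (firstV β μ₁ μ₂ ω, 0) := by
  simp only [gd, gradient_risk_left, gradient_risk_right_zero, firstV]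
  refine Prod.ext ?_ ?_
  · simp only [inner_zero_left, zero_div, mul_zero, Real.exp_zero, smul_neg, sub_neg_eq_add,
      zero_add, smul_smul, Finset.smul_sum]
    refine Finset.sum_congr rfl fun i _ => ?_
    congr 1
    ring
  · simp

lemma gd_two (β : ℝ) (μ₁ μ₂ : Token d) (ω : Fin n → Draw d) :
    gd (trainSet μ₁ μ₂ ω) β 2 =
      ((β / (2 * n)) • ∑ i, ((1 / 2 + lossWeight β μ₁ μ₂ ω i) * (ω i).y) •
          ((ω i).signal μ₁ μ₂ + (ω i).noise),
        (β / (4 * n)) • ∑ i, (lossWeight β μ₁ μ₂ ω i * ((ω i).y *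
          inner ℝ (firstV β μ₁ μ₂ ω) ((ω i).signal μ₁ μ₂ - (ω i).noise))) •
            ((ω i).signal μ₁ μ₂ - (ω i).noise)) := by
  rw [gd, gd_one]
  simp only [gradient_risk_left, gradient_risk_right_zero]
  refine Prod.ext ?_ ?_
  · simp only [smul_neg, sub_neg_eq_add]
    nth_rw 1 [firstV]
    simp only [smul_smul, Finset.smul_sum, ← Finset.sum_add_distrib, ← add_smul]
    refine Finset.sum_congr rfl fun i _ => ?_
    congr 1
    rw [lossWeight]
    ring
  · simp only [smul_neg, sub_neg_eq_add, zero_add, smul_smul, Finset.smul_sum]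
    refine Finset.sum_congr rfl fun i _ => ?_
    congr 1
    rw [lossWeight]
    ring

end

/-! ### Inner products of token combinations on a good training set -/

lemma Label.toReal_eq_one_or (y : Label) : y.toReal = 1 ∨ y.toReal = -1 := by
  rcases Int.units_eq_one_or y with rfl | rfl <;> simp [Label.toReal]

lemma Label.toReal_mul_self (y : Label) : y.toReal * y.toReal = 1 := by
  rcases y.toReal_eq_one_or with h | h <;> simp [h]

lemma Label.abs_toReal (y : Label) : |y.toReal| = 1 := by
  rcases y.toReal_eq_one_or with h | h <;> simp [h]

lemma Label.toReal_mul (x y : Label) : Label.toReal (x * y) = x.toReal * y.toReal := by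
  simp [Label.toReal]

lemma Label.toReal_one : Label.toReal 1 = 1 := by simp [Label.toReal]

lemma Label.toReal_neg_one : Label.toReal (-1) = -1 := by simp [Label.toReal]

lemma Draw.y_eq {d : ℕ} (ω : Draw d) : ω.y = ω.flip.toReal * ω.cleanLabel.toReal := by
  rw [Draw.y, Draw.label, Label.toReal_mul]

lemma Draw.y_mul_self {d : ℕ} (ω : Draw d) : ω.y * ω.y = 1 := Label.toReal_mul_self _

lemma Draw.abs_y {d : ℕ} (ω : Draw d) : |ω.y| = 1 := Label.abs_toReal _

section

variable {d n : ℕ}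

/-- A linear combination of the vectors `u_j + s ξ_j`. -/
noncomputable def comb (μ₁ μ₂ : Token d) (ω : Fin n → Draw d) (c : Fin n → ℝ) (s : ℝ) : Token d :=
  ∑ j, c j • ((ω j).signal μ₁ μ₂ + s • (ω j).noise)

/-- The sum of the weights `h` over one class, with noisy samples counted negatively. -/
noncomputable def classSum (ω : Fin n → Draw d) (τ : Label) (h : Fin n → ℝ) : ℝ :=
  ∑ j, if (ω j).cleanLabel = τ then (ω j).flip.toReal * h j else 0

variable {ε ρ : ℝ} {μ₁ μ₂ : Token d} {ω : Fin n → Draw d}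

lemma inner_signal_signal (h₁ : ‖μ₁‖ = ρ) (h₂ : ‖μ₂‖ = ρ) (h : inner ℝ μ₁ μ₂ = 0)
    (a b : Draw d) :
    inner ℝ (a.signal μ₁ μ₂) (b.signal μ₁ μ₂) = if a.cleanLabel = b.cleanLabel then ρ ^ 2 else 0 := by
  have h' : inner ℝ μ₂ μ₁ = 0 := by rw [real_inner_comm]; exact h
  have hne : (-1 : Label) ≠ 1 := by decide
  rcases Int.units_eq_one_or a.cleanLabel with ha | ha <;>
    rcases Int.units_eq_one_or b.cleanLabel with hb | hb <;>
    simp [Draw.signal, ha, hb, h, h', h₁, h₂, hne, hne.symm]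

lemma IsGood.inner_noise_signal (hg : IsGood ε μ₁ μ₂ ω) (i : Fin n) (b : Draw d) :
    inner ℝ (ω i).noise (b.signal μ₁ μ₂) = 0 := by
  rw [real_inner_comm, Draw.signal]
  split_ifs
  · exact hg.inner_noise₁ i
  · exact hg.inner_noise₂ i

lemma IsGood.inner_comb_signal (hg : IsGood ε μ₁ μ₂ ω) (h₁ : ‖μ₁‖ = ρ) (h₂ : ‖μ₂‖ = ρ)
    (h : inner ℝ μ₁ μ₂ = 0) (c : Fin n → ℝ) (s : ℝ) (b : Draw d) :
    inner ℝ (comb μ₁ μ₂ ω c s) (b.signal μ₁ μ₂) =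
      ρ ^ 2 * ∑ j, if (ω j).cleanLabel = b.cleanLabel then c j else 0 := by
  rw [comb, sum_inner, Finset.mul_sum]
  refine Finset.sum_congr rfl fun j _ => ?_
  rw [real_inner_smul_left, inner_add_left, real_inner_smul_left, hg.inner_noise_signal,
    inner_signal_signal h₁ h₂ h]
  split_ifs <;> ring

lemma IsGood.inner_comb_flip_signal (hg : IsGood ε μ₁ μ₂ ω) (h₁ : ‖μ₁‖ = ρ) (h₂ : ‖μ₂‖ = ρ)
    (h : inner ℝ μ₁ μ₂ = 0) (k : Fin n → ℝ) (s : ℝ) (b : Draw d) :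
    inner ℝ (comb μ₁ μ₂ ω (fun j => (ω j).flip.toReal * k j) s) (b.signal μ₁ μ₂) =
      ρ ^ 2 * classSum ω b.cleanLabel k :=
  hg.inner_comb_signal h₁ h₂ h _ s b

/-- Only samples of the same class meet `b.signal`. Within a class the clean labels agree and square
to one, so only the flip signs survive. -/
lemma IsGood.inner_comb_label_signal (hg : IsGood ε μ₁ μ₂ ω) (h₁ : ‖μ₁‖ = ρ) (h₂ : ‖μ₂‖ = ρ)
    (h : inner ℝ μ₁ μ₂ = 0) (k : Fin n → ℝ) (s : ℝ) (b : Draw d) :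
    b.cleanLabel.toReal *
      inner ℝ (comb μ₁ μ₂ ω (fun j => (ω j).y * k j) s) (b.signal μ₁ μ₂) =
      ρ ^ 2 * classSum ω b.cleanLabel k := by
  rw [hg.inner_comb_signal h₁ h₂ h, classSum, mul_left_comm, Finset.mul_sum]
  congr 1
  refine Finset.sum_congr rfl fun j _ => ?_
  split_ifs with hj
  · rw [Draw.y_eq, hj]
    linear_combination ((ω j).flip.toReal * k j) * b.cleanLabel.toReal_mul_self
  · simp

/-- The signals vanish against noise, and fewer than `n` off-diagonal terms remain, each at most `H
ε d / n`. -/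
lemma IsGood.abs_inner_comb_noise_sub_le (hg : IsGood ε μ₁ μ₂ ω) (hn : 0 < n) (hε : 0 ≤ ε)
    {c : Fin n → ℝ} {H : ℝ} (hc : ∀ j, |c j| ≤ H) (s : ℝ) (hs : |s| = 1) (i : Fin n) :
    |inner ℝ (comb μ₁ μ₂ ω c s) (ω i).noise - s * c i * ‖(ω i).noise‖ ^ 2| ≤ H * ε * d := by
  have hH : 0 ≤ H := (abs_nonneg _).trans (hc i)
  have hn' : (0 : ℝ) < n := by exact_mod_cast hn
  have e : inner ℝ (comb μ₁ μ₂ ω c s) (ω i).noise - s * c i * ‖(ω i).noise‖ ^ 2 =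
      ∑ j ∈ Finset.univ.erase i, s * c j * inner ℝ (ω j).noise (ω i).noise := by
    rw [comb, sum_inner, ← Finset.add_sum_erase _ _ (Finset.mem_univ i)]
    have : ∀ j, inner ℝ (c j • ((ω j).signal μ₁ μ₂ + s • (ω j).noise)) (ω i).noise =
        s * c j * inner ℝ (ω j).noise (ω i).noise := by
      intro j
      rw [real_inner_smul_left, inner_add_left, real_inner_smul_left,
        real_inner_comm _ ((ω j).signal μ₁ μ₂), hg.inner_noise_signal]
      ring
    simp_rw [this, real_inner_self_eq_norm_sq]
    ring
  rw [e]
  refine (Finset.abs_sum_le_sum_abs _ _).trans ?_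
  have hb : ∀ j ∈ Finset.univ.erase i,
      |s * c j * inner ℝ (ω j).noise (ω i).noise| ≤ H * (ε * d / n) := by
    intro j hj
    rw [abs_mul, abs_mul, hs, one_mul]
    exact mul_le_mul (hc j) (hg.abs_inner_le j i (Finset.ne_of_mem_erase hj)) (abs_nonneg _) hH
  refine (Finset.sum_le_sum hb).trans ?_
  have hcard : ((Finset.univ.erase i).card : ℝ) ≤ n := by
    have := Finset.card_le_univ (Finset.univ.erase i)
    rw [Fintype.card_fin] at this
    exact_mod_cast this
  rw [Finset.sum_const, nsmul_eq_mul]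
  calc ((Finset.univ.erase i).card : ℝ) * (H * (ε * d / n)) ≤ n * (H * (ε * d / n)) := by gcongr
    _ = H * ε * d := by field_simp

/-- At least `n/4` clean samples contribute `a` or more, and at most `ε n` noisy ones subtract up to
`H`. -/
lemma IsGood.le_classSum (hg : IsGood ε μ₁ μ₂ ω) (τ : Label) {k : Fin n → ℝ} {a H : ℝ}
    (ha : 0 ≤ a) (hH : 0 ≤ H) (hclean : ∀ j, (ω j).flip = 1 → a ≤ k j)
    (hnoisy : ∀ j, (ω j).flip = -1 → k j ≤ H) :
    n * (a / 4 - H * ε) ≤ classSum ω τ k := by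
  have hterm : ∀ j, (if (ω j).cleanLabel = τ ∧ (ω j).flip = 1 then a else 0) -
      (if (ω j).flip = -1 then H else 0) ≤
      if (ω j).cleanLabel = τ then (ω j).flip.toReal * k j else 0 := by
    intro j
    have hne : (1 : Label) ≠ -1 := by decide
    rcases Int.units_eq_one_or (ω j).flip with hf | hf <;> by_cases hj : (ω j).cleanLabel = τ
    · simpa [hf, hj, hne, Label.toReal_one] using hclean j hf
    · simp [hf, hj, hne]
    · simpa [hf, hj, hne.symm, Label.toReal_neg_one] using hnoisy j hf
    · simpa [hf, hj] using hH
  refine le_trans ?_ (Finset.sum_le_sum fun j _ => hterm j)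
  rw [Finset.sum_sub_distrib, ← Finset.sum_filter, ← Finset.sum_filter, Finset.sum_const,
    Finset.sum_const, nsmul_eq_mul, nsmul_eq_mul]
  have e1 := mul_le_mul_of_nonneg_right (hg.le_card_clean τ) ha
  have e2 := mul_le_mul_of_nonneg_right hg.card_noisy_le hH
  linarith

lemma classSum_le (ω : Fin n → Draw d) (τ : Label) {k : Fin n → ℝ} {b : ℝ} (hb : 0 ≤ b)
    (hclean : ∀ j, (ω j).flip = 1 → k j ≤ b) (hnoisy : ∀ j, (ω j).flip = -1 → 0 ≤ k j) :
    classSum ω τ k ≤ n * b := by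
  have hterm : ∀ j, (if (ω j).cleanLabel = τ then (ω j).flip.toReal * k j else 0) ≤ b := by
    intro j
    split_ifs
    · rcases Int.units_eq_one_or (ω j).flip with hf | hf
      · simpa [hf, Label.toReal_one] using hclean j hf
      · rw [hf, Label.toReal_neg_one]
        linarith [hnoisy j hf]
    · exact hb
  refine (Finset.sum_le_sum fun j _ => hterm j).trans ?_
  simp

/-- The projection kills the signals, and the triangle inequality handles the noise. Using no
cancellation costs a factor `√n`; this is the source of `n²/d`, rather than `n/d`, in the test
error. -/
lemma IsGood.norm_noiseProj_comb_le (hg : IsGood ε μ₁ μ₂ ω) (hρ : 0 < ρ) (h₁ : ‖μ₁‖ = ρ)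
    (h₂ : ‖μ₂‖ = ρ) (h : inner ℝ μ₁ μ₂ = 0) {c : Fin n → ℝ} {H : ℝ} (hc : ∀ j, |c j| ≤ H)
    (hH : 0 ≤ H) (s : ℝ) (hs : |s| = 1) :
    ‖noiseProj ρ μ₁ μ₂ (comb μ₁ μ₂ ω c s)‖ ≤ n * (H * √(2 * d)) := by
  have hsig : ∀ b : Draw d, noiseProj ρ μ₁ μ₂ (b.signal μ₁ μ₂) = 0 := by
    intro b
    have h' : inner ℝ μ₂ μ₁ = 0 := by rw [real_inner_comm]; exact h
    have hρ' : ρ ≠ 0 := hρ.ne'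
    rw [noiseProj_apply, Draw.signal]
    split_ifs <;> simp [h, h', h₁, h₂, hρ']
  rw [comb, map_sum]
  refine (norm_sum_le _ _).trans ((Finset.sum_le_sum (g := fun _ => H * √(2 * d)) ?_).trans ?_)
  · intro j _
    rw [map_smul, map_add, map_smul, hsig,
      noiseProj_eq_self (hg.inner_noise₁ j) (hg.inner_noise₂ j), zero_add, norm_smul, norm_smul,
      Real.norm_eq_abs, Real.norm_eq_abs, hs, one_mul]
    exact mul_le_mul (hc j) (Real.le_sqrt_of_sq_le (hg.norm_sq_le j)) (norm_nonneg _) hH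
  · simp

end

/-! ### Size of the iterates after one and two steps -/

section

variable {d n : ℕ} {ε ρ β K R : ℝ} {μ₁ μ₂ : Token d} {ω : Fin n → Draw d}

lemma exp_neg_small {X : ℝ} (hX : 576 ≤ X) :
    Real.exp (-(3 / 100 * X)) ≤ 1 / 100 ∧ X ^ 2 * Real.exp (-(3 / 100 * X)) ≤ 100 := by
  -- The fourth Taylor term dominates `X ^ 2`; the second suffices for the bare exponential.
  have h4 := Real.pow_div_factorial_le_exp (3 / 100 * X) (by linarith) 4
  have h2 := Real.pow_div_factorial_le_exp (3 / 100 * X) (by linarith) 2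
  simp only [Nat.factorial] at h4 h2
  norm_num at h4 h2
  rw [Real.exp_neg]
  have hpos := Real.exp_pos (3 / 100 * X)
  have hX2 : 576 ^ 2 ≤ X ^ 2 := by gcongr
  constructor
  · rw [inv_le_comm₀ hpos (by norm_num)]
    norm_num
    nlinarith
  · rw [← div_eq_mul_inv, div_le_iff₀ hpos]
    nlinarith [sq_nonneg (X ^ 2)]

lemma inv_one_add_exp_le (z : ℝ) : (1 + Real.exp z)⁻¹ ≤ Real.exp (-z) := by
  rw [Real.exp_neg]
  gcongr
  linarith

lemma one_sub_exp_le_inv (z : ℝ) : 1 - Real.exp z ≤ (1 + Real.exp z)⁻¹ := by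
  rw [← one_div, le_div_iff₀ (by positivity)]
  nlinarith [sq_nonneg (Real.exp z)]

lemma half_exp_neg_le_inv {z b : ℝ} (hz : z ≤ b) (hb : 0 ≤ b) :
    Real.exp (-b) / 2 ≤ (1 + Real.exp z)⁻¹ := by
  rw [← one_div, le_div_iff₀ (by positivity)]
  have h1 : Real.exp z ≤ Real.exp b := Real.exp_le_exp.2 hz
  have h2 : 1 ≤ Real.exp b := Real.one_le_exp hb
  calc Real.exp (-b) / 2 * (1 + Real.exp z) ≤ Real.exp (-b) / 2 * (2 * Real.exp b) := by
        gcongr; linarith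
    _ = Real.exp (-b) * Real.exp b := by ring
    _ = 1 := by rw [← Real.exp_add]; simp

/-- The scaling of the parameters, together with the properties of the draws, under which two steps
of gradient descent are analysed. -/
structure Scaled (ε ρ β K R : ℝ) (μ₁ μ₂ : Token d) (ω : Fin n → Draw d) : Prop where
  good : IsGood ε μ₁ μ₂ ω
  rho_pos : 0 < ρ
  norm₁ : ‖μ₁‖ = ρ
  norm₂ : ‖μ₂‖ = ρ
  orth : inner ℝ μ₁ μ₂ = 0
  n_pos : 0 < n
  d_pos : 0 < d
  le_K : 16 ≤ K
  le_R : 36 ≤ R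
  beta_eq : β = K * (n / d)
  rho_sq : ρ ^ 2 = R * (d / n)
  eps_nonneg : 0 ≤ ε
  eps_le : ε ≤ Real.exp (-(K * R / 4)) / 100

namespace Scaled

variable (hs : Scaled ε ρ β K R μ₁ μ₂ ω)

include hs

lemma le_KR : 576 ≤ K * R := by nlinarith [hs.le_K, hs.le_R]

lemma K_le : 36 * K ≤ K * R := by nlinarith [hs.le_K, hs.le_R]

lemma eps_le' : ε ≤ 1 / 100 := by
  have h1 := hs.eps_le
  have h2 : Real.exp (-(K * R / 4)) ≤ 1 := Real.exp_le_one_iff.2 (by linarith [hs.le_KR])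
  linarith

lemma n_pos' : (0 : ℝ) < n := by exact_mod_cast hs.n_pos

lemma d_pos' : (0 : ℝ) < d := by exact_mod_cast hs.d_pos

lemma step_mul_signal (c x : ℝ) : (β / (c * n)) * (ρ ^ 2 * x) = K * R / c * (x / n) := by
  have := hs.n_pos'.ne'
  have := hs.d_pos'.ne'
  rw [hs.beta_eq, hs.rho_sq]
  field_simp

lemma step_mul_noise (c x : ℝ) : (β / (c * n)) * x = K / c * (x / d) := by
  have := hs.n_pos'.ne'
  have := hs.d_pos'.ne'
  rw [hs.beta_eq]
  field_simp

lemma le_classSum_div (τ : Label) {k : Fin n → ℝ} {a H : ℝ}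
    (ha : 0 ≤ a) (hH : 0 ≤ H) (hclean : ∀ j, (ω j).flip = 1 → a ≤ k j)
    (hnoisy : ∀ j, (ω j).flip = -1 → k j ≤ H) :
    a / 4 - H * ε ≤ classSum ω τ k / n := by
  rw [le_div_iff₀ hs.n_pos', mul_comm]
  exact hs.good.le_classSum τ ha hH hclean hnoisy

lemma classSum_div_le (τ : Label) {k : Fin n → ℝ} {b : ℝ} (hb : 0 ≤ b)
    (hclean : ∀ j, (ω j).flip = 1 → k j ≤ b) (hnoisy : ∀ j, (ω j).flip = -1 → 0 ≤ k j) :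
    classSum ω τ k / n ≤ b := by
  rw [div_le_iff₀ hs.n_pos', mul_comm]
  exact classSum_le ω τ hb hclean hnoisy

/-- The noise part of a combination is dominated by the diagonal term. -/
lemma inner_comb_noise {c : Fin n → ℝ} {H : ℝ} (hc : ∀ j, |c j| ≤ H) (s : ℝ) (h1 : |s| = 1)
    (i : Fin n) : ∃ a e : ℝ, 1 / 2 ≤ a ∧ a ≤ 2 ∧ |e| ≤ H * ε ∧
      inner ℝ (comb μ₁ μ₂ ω c s) (ω i).noise / d = s * c i * a + e := by
  have hd := hs.d_pos'
  refine ⟨‖(ω i).noise‖ ^ 2 / d, (inner ℝ (comb μ₁ μ₂ ω c s) (ω i).noise -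
    s * c i * ‖(ω i).noise‖ ^ 2) / d, ?_, ?_, ?_, ?_⟩
  · rw [le_div_iff₀ hd]; linarith [hs.good.le_norm_sq i]
  · rw [div_le_iff₀ hd]; exact hs.good.norm_sq_le i
  · rw [abs_div, abs_of_pos hd, div_le_iff₀ hd]
    exact hs.good.abs_inner_comb_noise_sub_le hs.n_pos hs.eps_nonneg hc s h1 i
  · field_simp
    ring

omit hs in
lemma firstV_eq : firstV β μ₁ μ₂ ω = (β / (4 * n)) • comb μ₁ μ₂ ω (fun j => (ω j).y * 1) 1 := by
  simp [firstV, comb]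

lemma firstV_signal (i : Fin n) :
    6 / 100 * (K * R) ≤
        (ω i).cleanLabel.toReal * inner ℝ (firstV β μ₁ μ₂ ω) ((ω i).signal μ₁ μ₂) ∧
      (ω i).cleanLabel.toReal * inner ℝ (firstV β μ₁ μ₂ ω) ((ω i).signal μ₁ μ₂) ≤ K * R / 4 := by
  rw [firstV_eq, real_inner_smul_left, mul_left_comm (Label.toReal _),
    hs.good.inner_comb_label_signal hs.norm₁ hs.norm₂ hs.orth, hs.step_mul_signal]
  have h1 := hs.le_classSum_div (ω i).cleanLabel (k := fun _ => 1) zero_le_one zero_le_one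
    (fun _ _ => le_rfl) (fun _ _ => le_rfl)
  have h2 := hs.classSum_div_le (ω i).cleanLabel (k := fun _ => 1) zero_le_one
    (fun _ _ => le_rfl) (fun _ _ => zero_le_one)
  have := hs.le_KR
  have := hs.eps_le'
  constructor <;> nlinarith

lemma firstV_noise (i : Fin n) :
    12 / 100 * K ≤ (ω i).y * inner ℝ (firstV β μ₁ μ₂ ω) (ω i).noise ∧
      (ω i).y * inner ℝ (firstV β μ₁ μ₂ ω) (ω i).noise ≤ 51 / 100 * K := by
  obtain ⟨a, e, ha, ha', he, h⟩ := hs.inner_comb_noise (c := fun j => (ω j).y * 1) (H := 1)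
    (fun j => by rw [mul_one, Draw.abs_y]) 1 abs_one i
  rw [firstV_eq, real_inner_smul_left, hs.step_mul_noise, h]
  have e1 : (ω i).y * (K / 4 * (1 * ((ω i).y * 1) * a + e)) = K / 4 * (a + (ω i).y * e) := by
    linear_combination (K / 4 * a) * (ω i).y_mul_self
  have e2 : |(ω i).y * e| ≤ 1 / 100 := by
    rw [abs_mul, Draw.abs_y]
    linarith [hs.eps_le']
  rw [e1]
  have := abs_le.1 e2
  have := hs.le_K
  constructor <;> nlinarith

omit hs in
lemma label_mul_inner_add (v : Token d) (b : Draw d) :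
    b.y * inner ℝ v (b.signal μ₁ μ₂ + b.noise) =
      b.flip.toReal * (b.cleanLabel.toReal * inner ℝ v (b.signal μ₁ μ₂)) +
        b.y * inner ℝ v b.noise := by
  rw [inner_add_right, Draw.y_eq]
  ring

omit hs in
lemma label_mul_inner_sub (v : Token d) (b : Draw d) :
    b.y * inner ℝ v (b.signal μ₁ μ₂ - b.noise) =
      b.flip.toReal * (b.cleanLabel.toReal * inner ℝ v (b.signal μ₁ μ₂)) -
        b.y * inner ℝ v b.noise := by
  rw [inner_sub_right, Draw.y_eq]
  ring

/-- The signal and noise parts of the margin are both positive. `R ≥ 36` makes the noise part small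
against `K R`, which keeps the margin below `K R / 4`. -/
lemma lossWeight_clean (i : Fin n) (hi : (ω i).flip = 1) :
    Real.exp (-(K * R / 4)) / 2 ≤ lossWeight β μ₁ μ₂ ω i ∧
      lossWeight β μ₁ μ₂ ω i ≤ Real.exp (-(3 / 100 * (K * R))) := by
  have := hs.K_le
  have := hs.le_K
  obtain ⟨hq, hq'⟩ := hs.firstV_signal i
  obtain ⟨hr, hr'⟩ := hs.firstV_noise i
  rw [lossWeight, ← mul_div_assoc, label_mul_inner_add, hi, Label.toReal_one, one_mul]
  constructor
  · apply half_exp_neg_le_inv <;> linarith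
  · exact (inv_one_add_exp_le _).trans (Real.exp_le_exp.2 (by linarith))

/-- The signal now enters with the wrong sign and outweighs the memorised noise; with `K R ≥ 576`
the margin is at most `-12`. -/
lemma lossWeight_noisy (i : Fin n) (hi : (ω i).flip = -1) :
    9 / 10 ≤ lossWeight β μ₁ μ₂ ω i := by
  have := hs.K_le
  have := hs.le_K
  obtain ⟨hq, hq'⟩ := hs.firstV_signal i
  obtain ⟨hr, hr'⟩ := hs.firstV_noise i
  rw [lossWeight, ← mul_div_assoc, label_mul_inner_add, hi, Label.toReal_neg_one]
  refine le_trans ?_ (one_sub_exp_le_inv _)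
  have h1 : Real.exp ((-1 * ((ω i).cleanLabel.toReal *
      inner ℝ (firstV β μ₁ μ₂ ω) ((ω i).signal μ₁ μ₂)) +
        (ω i).y * inner ℝ (firstV β μ₁ μ₂ ω) (ω i).noise) / 2) ≤ Real.exp (-12) :=
    Real.exp_le_exp.2 (by linarith)
  have h2 : Real.exp (-12) ≤ 1 / 13 := by
    rw [Real.exp_neg, inv_le_comm₀ (Real.exp_pos _) (by norm_num)]
    have := Real.add_one_le_exp (12 : ℝ)
    linarith
  linarith

omit hs in
lemma lossWeight_pos (i : Fin n) : 0 < lossWeight β μ₁ μ₂ ω i := by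
  rw [lossWeight]; positivity

omit hs in
lemma lossWeight_le_one (i : Fin n) : lossWeight β μ₁ μ₂ ω i ≤ 1 := by
  rw [lossWeight]
  exact inv_le_one_of_one_le₀ (by linarith [Real.exp_pos ((ω i).y *
    (inner ℝ (firstV β μ₁ μ₂ ω) ((ω i).signal μ₁ μ₂ + (ω i).noise) / 2))])

end Scaled

/-- The coefficient, up to the sign of the flip, of sample `i` in the second step of `p`. -/
noncomputable def pWeight (β : ℝ) (μ₁ μ₂ : Token d) (ω : Fin n → Draw d) (i : Fin n) : ℝ :=
  lossWeight β μ₁ μ₂ ω i *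
    ((ω i).cleanLabel.toReal * inner ℝ (firstV β μ₁ μ₂ ω) ((ω i).signal μ₁ μ₂) -
      (ω i).flip.toReal * ((ω i).y * inner ℝ (firstV β μ₁ μ₂ ω) (ω i).noise))

lemma lossWeight_mul_eq (i : Fin n) :
    lossWeight β μ₁ μ₂ ω i * ((ω i).y *
      inner ℝ (firstV β μ₁ μ₂ ω) ((ω i).signal μ₁ μ₂ - (ω i).noise)) =
    (ω i).flip.toReal * pWeight β μ₁ μ₂ ω i := by
  rw [Scaled.label_mul_inner_sub, pWeight]
  linear_combination (lossWeight β μ₁ μ₂ ω i * ((ω i).y *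
    inner ℝ (firstV β μ₁ μ₂ ω) (ω i).noise)) * (ω i).flip.toReal_mul_self

lemma gd_two_fst (β : ℝ) (μ₁ μ₂ : Token d) (ω : Fin n → Draw d) :
    (gd (trainSet μ₁ μ₂ ω) β 2).1 =
      (β / (2 * n)) • comb μ₁ μ₂ ω (fun j => (ω j).y * (1 / 2 + lossWeight β μ₁ μ₂ ω j)) 1 := by
  rw [gd_two]
  simp only [comb, one_smul, mul_comm]

lemma gd_two_snd (β : ℝ) (μ₁ μ₂ : Token d) (ω : Fin n → Draw d) :
    (gd (trainSet μ₁ μ₂ ω) β 2).2 =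
      (β / (4 * n)) • comb μ₁ μ₂ ω (fun j => (ω j).flip.toReal * pWeight β μ₁ μ₂ ω j) (-1) := by
  rw [gd_two]
  simp only [comb, lossWeight_mul_eq, neg_one_smul, ← sub_eq_add_neg]

namespace Scaled

variable (hs : Scaled ε ρ β K R μ₁ μ₂ ω)

include hs

lemma pWeight_clean (i : Fin n) (hi : (ω i).flip = 1) :
    2 / 100 * (K * R) * Real.exp (-(K * R / 4)) ≤ pWeight β μ₁ μ₂ ω i ∧
      pWeight β μ₁ μ₂ ω i ≤ K * R / 4 * Real.exp (-(3 / 100 * (K * R))) := by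
  have := hs.K_le
  have := hs.le_K
  obtain ⟨hq, hq'⟩ := hs.firstV_signal i
  obtain ⟨hr, hr'⟩ := hs.firstV_noise i
  obtain ⟨hg, hg'⟩ := hs.lossWeight_clean i hi
  rw [pWeight, hi, Label.toReal_one, one_mul]
  have hE := Real.exp_pos (-(K * R / 4))
  constructor
  · refine le_trans (le_of_eq ?_) (mul_le_mul hg (?_ : 4 / 100 * (K * R) ≤ _) (by linarith)
      (lossWeight_pos i).le)
    · ring
    · linarith
  · rw [mul_comm (K * R / 4)]
    exact mul_le_mul hg' (by linarith) (by linarith) (Real.exp_pos _).le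

lemma pWeight_noisy (i : Fin n) (hi : (ω i).flip = -1) :
    5 / 100 * (K * R) ≤ pWeight β μ₁ μ₂ ω i ∧ pWeight β μ₁ μ₂ ω i ≤ 27 / 100 * (K * R) := by
  have := hs.K_le
  have := hs.le_K
  obtain ⟨hq, hq'⟩ := hs.firstV_signal i
  obtain ⟨hr, hr'⟩ := hs.firstV_noise i
  have hg := hs.lossWeight_noisy i hi
  have hg' := lossWeight_le_one (β := β) (μ₁ := μ₁) (μ₂ := μ₂) (ω := ω) i
  rw [pWeight, hi, Label.toReal_neg_one]
  constructor
  · refine le_trans ?_ (mul_le_mul hg (?_ : 6 / 100 * (K * R) ≤ _) (by linarith)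
      (lossWeight_pos i).le)
    · linarith
    · linarith
  · rw [← one_mul (27 / 100 * (K * R))]
    exact mul_le_mul hg' (by linarith) (by linarith) zero_le_one

lemma abs_flip_mul_pWeight_le (i : Fin n) :
    |(ω i).flip.toReal * pWeight β μ₁ μ₂ ω i| ≤ 27 / 100 * (K * R) := by
  have hX := hs.le_KR
  rw [abs_mul, Label.abs_toReal, one_mul]
  rcases Int.units_eq_one_or (ω i).flip with hi | hi
  · obtain ⟨h1, h2⟩ := hs.pWeight_clean i hi
    have h3 := (exp_neg_small hX).1
    have h4 : 0 ≤ 2 / 100 * (K * R) * Real.exp (-(K * R / 4)) := by positivity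
    rw [abs_of_nonneg (by linarith)]
    nlinarith
  · obtain ⟨h1, h2⟩ := hs.pWeight_noisy i hi
    rw [abs_of_nonneg (by linarith)]
    exact h2

omit hs in
lemma abs_label_mul_le (i : Fin n) :
    |(ω i).y * (1 / 2 + lossWeight β μ₁ μ₂ ω i)| ≤ 3 / 2 := by
  have h1 := lossWeight_pos (β := β) (μ₁ := μ₁) (μ₂ := μ₂) (ω := ω) i
  have h2 := lossWeight_le_one (β := β) (μ₁ := μ₁) (μ₂ := μ₂) (ω := ω) i
  rw [abs_mul, Draw.abs_y, one_mul, abs_of_nonneg (by linarith)]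
  linarith

lemma p_signal (b : Draw d) :
    0 < inner ℝ (gd (trainSet μ₁ μ₂ ω) β 2).2 (b.signal μ₁ μ₂) ∧
      inner ℝ (gd (trainSet μ₁ μ₂ ω) β 2).2 (b.signal μ₁ μ₂) ≤ 25 / 4 := by
  have hX := hs.le_KR
  have hE := Real.exp_pos (-(K * R / 4))
  rw [gd_two_snd, real_inner_smul_left,
    hs.good.inner_comb_flip_signal hs.norm₁ hs.norm₂ hs.orth, hs.step_mul_signal]
  have h1 := hs.le_classSum_div b.cleanLabel (k := pWeight β μ₁ μ₂ ω)
    (a := 2 / 100 * (K * R) * Real.exp (-(K * R / 4))) (H := 27 / 100 * (K * R)) (by positivity)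
    (by positivity) (fun j hj => (hs.pWeight_clean j hj).1) (fun j hj => (hs.pWeight_noisy j hj).2)
  have h2 := hs.classSum_div_le b.cleanLabel (k := pWeight β μ₁ μ₂ ω)
    (b := K * R / 4 * Real.exp (-(3 / 100 * (K * R)))) (by positivity)
    (fun j hj => (hs.pWeight_clean j hj).2)
    (fun j hj => le_trans (by positivity) (hs.pWeight_noisy j hj).1)
  have h3 := (exp_neg_small hX).2
  -- This is where `ε` must be comparable to `exp(-KR/4)`: the noisy share `27/10000` stays below
  -- the clean share `(2/100)/4`, both in units of `K R exp(-KR/4)`.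
  have h4 := mul_le_mul_of_nonneg_left hs.eps_le (by positivity : 0 ≤ 27 / 100 * (K * R))
  have h5 : 0 < K * R * Real.exp (-(K * R / 4)) := by positivity
  constructor
  · apply mul_pos (by linarith)
    linarith
  -- The bound is `(KR)² exp(-3KR/100) / 16 ≤ 100/16 = 25/4`.
  · have := mul_le_mul_of_nonneg_left h2 (by linarith : 0 ≤ K * R / 4)
    nlinarith

/-- The sample's own term has a tiny weight, of order `K R exp(-KR/4)`. The cross terms carry the
large noisy weights but also the factor `ε`, so they are still smaller. -/
lemma p_noise_clean (i : Fin n) (hi : (ω i).flip = 1) :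
    inner ℝ (gd (trainSet μ₁ μ₂ ω) β 2).2 (ω i).noise < 0 := by
  have hX := hs.le_KR
  have hK := hs.le_K
  have hE := Real.exp_pos (-(K * R / 4))
  obtain ⟨a, e, ha, ha', he, h⟩ := hs.inner_comb_noise hs.abs_flip_mul_pWeight_le (-1)
    (by simp) i
  rw [gd_two_snd, real_inner_smul_left, hs.step_mul_noise, h, hi, Label.toReal_one]
  have h1 := (hs.pWeight_clean i hi).1
  have h4 := mul_le_mul_of_nonneg_left hs.eps_le (by positivity : 0 ≤ 27 / 100 * (K * R))
  have h5 : 0 < K * R * Real.exp (-(K * R / 4)) := by positivity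
  have h6 := (abs_le.1 he).2
  have h7 := mul_le_mul h1 ha (by norm_num) (by linarith)
  apply mul_neg_of_pos_of_neg (by linarith)
  linarith

lemma p_noise_noisy (i : Fin n) (hi : (ω i).flip = -1) :
    8 / 100 * (K * R) ≤ inner ℝ (gd (trainSet μ₁ μ₂ ω) β 2).2 (ω i).noise := by
  have hX := hs.le_KR
  have hK := hs.le_K
  obtain ⟨a, e, ha, ha', he, h⟩ := hs.inner_comb_noise hs.abs_flip_mul_pWeight_le (-1)
    (by simp) i
  rw [gd_two_snd, real_inner_smul_left, hs.step_mul_noise, h, hi, Label.toReal_neg_one]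
  have h1 := (hs.pWeight_noisy i hi).1
  have h4 := mul_le_mul_of_nonneg_left hs.eps_le' (by positivity : 0 ≤ 27 / 100 * (K * R))
  have h6 := (abs_le.1 he).1
  have h7 := mul_le_mul h1 ha (by norm_num) (by linarith)
  have h8 : 2 / 100 * (K * R) ≤ -1 * (-1 * pWeight β μ₁ μ₂ ω i) * a + e := by linarith
  have h9 := mul_le_mul_of_nonneg_left h8 (by linarith : 0 ≤ K / 4)
  -- `K ≥ 16` turns `K/4 · (2/100) K R` into `(8/100) K R`.
  nlinarith

lemma v_signal (b : Draw d) :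
    K * R / 20 ≤ b.cleanLabel.toReal *
        inner ℝ (gd (trainSet μ₁ μ₂ ω) β 2).1 (b.signal μ₁ μ₂) ∧
      b.cleanLabel.toReal * inner ℝ (gd (trainSet μ₁ μ₂ ω) β 2).1 (b.signal μ₁ μ₂) ≤
        255 / 1000 * (K * R) := by
  have hX := hs.le_KR
  rw [gd_two_fst, real_inner_smul_left, mul_left_comm,
    hs.good.inner_comb_label_signal hs.norm₁ hs.norm₂ hs.orth, hs.step_mul_signal]
  have hp := lossWeight_pos (β := β) (μ₁ := μ₁) (μ₂ := μ₂) (ω := ω)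
  have hle := lossWeight_le_one (β := β) (μ₁ := μ₁) (μ₂ := μ₂) (ω := ω)
  have h1 := hs.le_classSum_div b.cleanLabel (k := fun j => 1 / 2 + lossWeight β μ₁ μ₂ ω j)
    (a := 1 / 2) (H := 3 / 2) (by norm_num) (by norm_num)
    (fun j _ => by linarith [hp j]) (fun j _ => by linarith [hle j])
  have h2 := hs.classSum_div_le b.cleanLabel (k := fun j => 1 / 2 + lossWeight β μ₁ μ₂ ω j)
    (b := 51 / 100) (by norm_num)
    (fun j hj => by linarith [(hs.lossWeight_clean j hj).2, (exp_neg_small hX).1])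
    (fun j _ => by linarith [hp j])
  have := hs.eps_le'
  constructor <;> nlinarith

lemma v_noise (i : Fin n) :
    K / 2 * ((1 / 2 + lossWeight β μ₁ μ₂ ω i) / 2 - 15 / 1000) ≤
      (ω i).y * inner ℝ (gd (trainSet μ₁ μ₂ ω) β 2).1 (ω i).noise := by
  have hK := hs.le_K
  obtain ⟨a, e, ha, ha', he, h⟩ := hs.inner_comb_noise abs_label_mul_le 1 abs_one i
  rw [gd_two_fst, real_inner_smul_left, hs.step_mul_noise, h]
  set g := lossWeight β μ₁ μ₂ ω i with hg
  have hg0 : 0 < g := lossWeight_pos i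
  have e1 : (ω i).y * (K / 2 * (1 * ((ω i).y * (1 / 2 + g)) * a + e)) =
      K / 2 * ((1 / 2 + g) * a + (ω i).y * e) := by
    linear_combination (K / 2 * (1 / 2 + g) * a) * (ω i).y_mul_self
  have e2 : |(ω i).y * e| ≤ 15 / 1000 := by
    rw [abs_mul, Draw.abs_y]
    linarith [hs.eps_le']
  rw [e1]
  have h1 := (abs_le.1 e2).1
  apply mul_le_mul_of_nonneg_left _ (by linarith)
  nlinarith

lemma v_noise_pos (i : Fin n) :
    0 < (ω i).y * inner ℝ (gd (trainSet μ₁ μ₂ ω) β 2).1 (ω i).noise := by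
  refine lt_of_lt_of_le ?_ (hs.v_noise i)
  have := lossWeight_pos (β := β) (μ₁ := μ₁) (μ₂ := μ₂) (ω := ω) i
  have := hs.le_K
  apply mul_pos <;> linarith

lemma v_noise_noisy (i : Fin n) (hi : (ω i).flip = -1) :
    34 / 100 * K ≤ (ω i).y * inner ℝ (gd (trainSet μ₁ μ₂ ω) β 2).1 (ω i).noise := by
  refine le_trans ?_ (hs.v_noise i)
  have := hs.lossWeight_noisy i hi
  have := hs.le_K
  nlinarith

lemma norm_sq_noiseProj_v_le :
    ‖noiseProj ρ μ₁ μ₂ (gd (trainSet μ₁ μ₂ ω) β 2).1‖ ^ 2 ≤ (K * R) ^ 4 * (n ^ 2 / d) := by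
  have hK := hs.le_K
  have hX := hs.le_KR
  have hKX := hs.K_le
  have hd := hs.d_pos'
  have hn := hs.n_pos'
  have h1 := hs.good.norm_noiseProj_comb_le hs.rho_pos hs.norm₁ hs.norm₂ hs.orth
    (abs_label_mul_le (β := β) (μ₁ := μ₁) (μ₂ := μ₂) (ω := ω)) (by norm_num) 1 abs_one
  rw [gd_two_fst, map_smul, norm_smul, mul_pow, Real.norm_eq_abs, sq_abs]
  have h2 := pow_le_pow_left₀ (norm_nonneg _) h1 2
  have h3 := mul_le_mul_of_nonneg_left h2 (sq_nonneg (β / (2 * n)))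
  refine h3.trans ?_
  have e : (β / (2 * n)) ^ 2 * (n * (3 / 2 * √(2 * d))) ^ 2 = 9 / 8 * K ^ 2 * (n ^ 2 / d) := by
    rw [mul_pow, mul_pow, Real.sq_sqrt (by positivity), hs.beta_eq]
    field_simp
    norm_num
  rw [e]
  gcongr
  have h4 : K ^ 2 ≤ (K * R) ^ 2 := by gcongr; linarith
  have h5 : 2 ≤ (K * R) ^ 2 := by nlinarith
  calc 9 / 8 * K ^ 2 ≤ 2 * (K * R) ^ 2 := by nlinarith [sq_nonneg K]
    _ ≤ (K * R) ^ 2 * (K * R) ^ 2 := by gcongr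
    _ = (K * R) ^ 4 := by ring

lemma norm_sq_noiseProj_p_le :
    ‖noiseProj ρ μ₁ μ₂ (gd (trainSet μ₁ μ₂ ω) β 2).2‖ ^ 2 ≤ (K * R) ^ 4 * (n ^ 2 / d) := by
  have hK := hs.le_K
  have hX := hs.le_KR
  have hKX := hs.K_le
  have hd := hs.d_pos'
  have hn := hs.n_pos'
  have h1 := hs.good.norm_noiseProj_comb_le hs.rho_pos hs.norm₁ hs.norm₂ hs.orth
    hs.abs_flip_mul_pWeight_le (by positivity) (-1) (by simp)
  rw [gd_two_snd, map_smul, norm_smul, mul_pow, Real.norm_eq_abs, sq_abs]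
  have h2 := pow_le_pow_left₀ (norm_nonneg _) h1 2
  have h3 := mul_le_mul_of_nonneg_left h2 (sq_nonneg (β / (4 * n)))
  refine h3.trans ?_
  have e : (β / (4 * n)) ^ 2 * (n * (27 / 100 * (K * R) * √(2 * d))) ^ 2 =
      729 / 80000 * (K ^ 2 * (K * R) ^ 2) * (n ^ 2 / d) := by
    rw [mul_pow (n : ℝ), mul_pow (27 / 100 * (K * R)), Real.sq_sqrt (by positivity), hs.beta_eq]
    field_simp
    ring
  rw [e]
  gcongr
  have h4 : K ^ 2 ≤ (K * R) ^ 2 := by gcongr; linarith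
  have h5 : K ^ 2 * (K * R) ^ 2 ≤ (K * R) ^ 2 * (K * R) ^ 2 := by gcongr
  nlinarith [mul_self_nonneg ((K * R) ^ 2)]

end Scaled

end

/-! ### Attention, training labels and test error -/

lemma Label.toReal_eq_sign {y : Label} {f : ℝ} (h : 0 < y.toReal * f) : y.toReal = Real.sign f := by
  rcases y.toReal_eq_one_or with hy | hy
  · rw [hy, Real.sign_of_pos (by rw [hy] at h; linarith)]
  · rw [hy, Real.sign_of_neg (by rw [hy] at h; linarith)]

lemma measurable_real_sign : Measurable Real.sign :=
  Measurable.ite measurableSet_Iio measurable_const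
    (Measurable.ite measurableSet_Ioi measurable_const measurable_const)

section

variable {d n : ℕ} {ε ρ β K R : ℝ} {μ₁ μ₂ : Token d} {ω : Fin n → Draw d}

lemma attn_pos {d : ℕ} (X : Input d) (p : Token d) (j : Fin 2) : 0 < attn X p j :=
  div_pos (Real.exp_pos _) (Finset.sum_pos (fun _ _ => Real.exp_pos _) Finset.univ_nonempty)

lemma attn_le_one {d : ℕ} (X : Input d) (p : Token d) (j : Fin 2) : attn X p j ≤ 1 :=
  div_le_one_of_le₀ (Finset.single_le_sum (f := fun l => Real.exp (inner ℝ (X l) p))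
    (fun _ _ => (Real.exp_pos _).le) (Finset.mem_univ j))
    (Finset.sum_nonneg fun _ _ => (Real.exp_pos _).le)

lemma Draw.attn_pos_eq (p : Token d) (b : Draw d) :
    attn (b.input μ₁ μ₂) p b.pos =
      (1 + Real.exp (inner ℝ p b.noise - inner ℝ p (b.signal μ₁ μ₂)))⁻¹ := by
  rw [attn_eq _ _ b.noisePos_ne_pos.symm, b.input_pos, b.input_noisePos, real_inner_comm p,
    real_inner_comm p]

lemma Draw.attn_noisePos_eq (p : Token d) (b : Draw d) :
    attn (b.input μ₁ μ₂) p b.noisePos =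
      (1 + Real.exp (inner ℝ p (b.signal μ₁ μ₂) - inner ℝ p b.noise))⁻¹ := by
  rw [attn_eq _ _ b.noisePos_ne_pos, b.input_pos, b.input_noisePos, real_inner_comm p,
    real_inner_comm p]

lemma Draw.attn_add (p : Token d) (b : Draw d) :
    attn (b.input μ₁ μ₂) p b.pos + attn (b.input μ₁ μ₂) p b.noisePos = 1 := by
  rw [Draw.attn_pos_eq, Draw.attn_noisePos_eq,
    ← neg_sub (inner ℝ p b.noise) (inner ℝ p (b.signal μ₁ μ₂)), Real.exp_neg]
  have := Real.exp_pos (inner ℝ p b.noise - inner ℝ p (b.signal μ₁ μ₂))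
  field_simp
  ring

lemma Draw.label_mul_model (v p : Token d) (b : Draw d) :
    b.y * model v p (b.input μ₁ μ₂) =
      attn (b.input μ₁ μ₂) p b.pos *
        (b.flip.toReal * (b.cleanLabel.toReal * inner ℝ v (b.signal μ₁ μ₂))) +
      attn (b.input μ₁ μ₂) p b.noisePos * (b.y * inner ℝ v b.noise) := by
  rw [model_eq v p _ b.noisePos_ne_pos.symm, b.input_pos, b.input_noisePos, Draw.y_eq]
  ring

lemma flip_of_mem_cleanIdx {i : Fin n} (hi : i ∈ cleanIdx ω) : (ω i).flip = 1 := by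
  change (ω i).flip * (ω i).cleanLabel = (ω i).cleanLabel at hi
  exact mul_eq_right.1 hi

lemma flip_of_mem_noisyIdx {i : Fin n} (hi : i ∈ noisyIdx ω) : (ω i).flip = -1 := by
  change (ω i).flip * (ω i).cleanLabel = -(ω i).cleanLabel at hi
  rw [← neg_one_mul] at hi
  exact mul_right_cancel hi

lemma measurable_dataPoint (μ₁ μ₂ : Token d) : Measurable (Draw.dataPoint μ₁ μ₂) := by
  have hc : Measurable (Draw.cleanLabel : Draw d → Label) := measurable_fst
  have hf : Measurable (Draw.flip : Draw d → Label) := measurable_fst.comp measurable_snd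
  have hp : Measurable (Draw.pos : Draw d → Fin 2) :=
    measurable_fst.comp (measurable_snd.comp measurable_snd)
  have hx : Measurable (Draw.noise : Draw d → Token d) :=
    measurable_snd.comp (measurable_snd.comp measurable_snd)
  refine Measurable.prodMk (measurable_pi_iff.2 fun j => ?_) ?_
  · refine Measurable.ite ?_ (Measurable.ite ?_ measurable_const measurable_const) hx
    · exact measurableSet_eq_fun measurable_const hp
    · exact hc (measurableSet_singleton 1)
  · exact (measurable_of_finite fun z : Label × Label => z.1 * z.2).comp (hf.prodMk hc)

lemma measurableSet_misclassified (v p : Token d) :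
    MeasurableSet {z : Input d × Label | z.2.toReal ≠ Real.sign (model v p z.1)} := by
  have hm : Measurable fun X : Input d => model v p X := by
    unfold model attn softmax
    fun_prop
  have hy : Measurable Label.toReal := measurable_of_finite _
  exact (measurableSet_eq_fun (hy.comp measurable_snd)
    (measurable_real_sign.comp (hm.comp measurable_fst))).compl

namespace Scaled

variable (hs : Scaled ε ρ β K R μ₁ μ₂ ω)

include hs

lemma half_lt_attn_signal (i : Fin n) (hi : (ω i).flip = 1) :
    1 / 2 < attn ((ω i).input μ₁ μ₂) (gd (trainSet μ₁ μ₂ ω) β 2).2 (ω i).pos := by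
  rw [Draw.attn_pos_eq, one_div]
  have h1 := hs.p_noise_clean i hi
  have h2 := (hs.p_signal (ω i)).1
  have h3 : Real.exp (inner ℝ (gd (trainSet μ₁ μ₂ ω) β 2).2 (ω i).noise -
      inner ℝ (gd (trainSet μ₁ μ₂ ω) β 2).2 ((ω i).signal μ₁ μ₂)) < 1 :=
    Real.exp_lt_one_iff.2 (by linarith)
  gcongr
  linarith

lemma le_attn_noise (i : Fin n) (hi : (ω i).flip = -1) :
    1 - 1 / R ≤ attn ((ω i).input μ₁ μ₂) (gd (trainSet μ₁ μ₂ ω) β 2).2 (ω i).noisePos := by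
  rw [Draw.attn_noisePos_eq]
  have h1 := hs.p_noise_noisy i hi
  have h2 := (hs.p_signal (ω i)).2
  have hR := hs.le_R
  refine le_trans ?_ (one_sub_exp_le_inv _)
  have h3 : Real.exp (inner ℝ (gd (trainSet μ₁ μ₂ ω) β 2).2 ((ω i).signal μ₁ μ₂) -
      inner ℝ (gd (trainSet μ₁ μ₂ ω) β 2).2 (ω i).noise) ≤ Real.exp (-R) :=
    -- With `K ≥ 16` the logit gap is at least `1.28 R - 25/4`, which exceeds `R` since `R ≥ 36`.
    Real.exp_le_exp.2 (by nlinarith [hs.le_K])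
  have h4 : Real.exp (-R) ≤ 1 / R := by
    rw [Real.exp_neg, one_div]
    gcongr
    linarith [Real.add_one_le_exp R]
  linarith

lemma label_eq_sign (i : Fin n) :
    (ω i).y = Real.sign (model (gd (trainSet μ₁ μ₂ ω) β 2).1 (gd (trainSet μ₁ μ₂ ω) β 2).2
      ((ω i).input μ₁ μ₂)) := by
  apply Label.toReal_eq_sign
  change 0 < (ω i).y * _
  rw [Draw.label_mul_model]
  set p := (gd (trainSet μ₁ μ₂ ω) β 2).2
  have ha := attn_pos ((ω i).input μ₁ μ₂) p (ω i).pos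
  have ha' := attn_pos ((ω i).input μ₁ μ₂) p (ω i).noisePos
  obtain ⟨hv, hv'⟩ := hs.v_signal (ω i)
  have hX := hs.le_KR
  have hR := hs.le_R
  have hK := hs.le_K
  rcases Int.units_eq_one_or (ω i).flip with hi | hi
  · rw [hi, Label.toReal_one, one_mul]
    exact add_pos (mul_pos ha (by linarith)) (mul_pos ha' (hs.v_noise_pos i))
  · rw [hi, Label.toReal_neg_one]
    have h1 := hs.le_attn_noise i hi
    have h2 := hs.v_noise_noisy i hi
    have h3 := Draw.attn_add (μ₁ := μ₁) (μ₂ := μ₂) p (ω i)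
    have h4 : 1 / R ≤ 1 / 36 := one_div_le_one_div_of_le (by norm_num) hR
    have h5 : attn ((ω i).input μ₁ μ₂) p (ω i).pos ≤ 1 / R := by linarith
    have h6 := mul_le_mul h5 hv' (by linarith) (by positivity)
    -- The attention bound cancels the factor `R` of the signal, so `0.255 K` competes with `(35/36)
    -- · 0.34 K`.
    have h7 : 1 / R * (255 / 1000 * (K * R)) = 255 / 1000 * K := by
      field_simp
    have h8 : 35 / 36 * (34 / 100 * K) ≤ attn ((ω i).input μ₁ μ₂) p (ω i).noisePos *
        ((ω i).y * inner ℝ (gd (trainSet μ₁ μ₂ ω) β 2).1 (ω i).noise) :=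
      mul_le_mul (by linarith) h2 (by positivity) ha'.le
    linarith

/-- The signal gets attention at least `1/(1+e) ≥ 1/4` and contributes at least `K R / 80 > 1`,
while the noise contributes at most `1` in absolute value. -/
lemma label_eq_sign_test (b : Draw d) (hb : b.flip = 1)
    (hp : inner ℝ (gd (trainSet μ₁ μ₂ ω) β 2).2 b.noise < 1)
    (hv : |inner ℝ (gd (trainSet μ₁ μ₂ ω) β 2).1 b.noise| < 1) :
    b.y = Real.sign (model (gd (trainSet μ₁ μ₂ ω) β 2).1 (gd (trainSet μ₁ μ₂ ω) β 2).2
      (b.input μ₁ μ₂)) := by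
  apply Label.toReal_eq_sign
  change 0 < b.y * _
  rw [Draw.label_mul_model, hb, Label.toReal_one, one_mul]
  have hX := hs.le_KR
  have h1 := (hs.v_signal b).1
  have h2 := (hs.p_signal b).1
  have h3 : 1 / 4 ≤ attn (b.input μ₁ μ₂) (gd (trainSet μ₁ μ₂ ω) β 2).2 b.pos := by
    rw [Draw.attn_pos_eq, one_div]
    have : Real.exp (inner ℝ (gd (trainSet μ₁ μ₂ ω) β 2).2 b.noise -
        inner ℝ (gd (trainSet μ₁ μ₂ ω) β 2).2 (b.signal μ₁ μ₂)) ≤ Real.exp 1 :=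
      Real.exp_le_exp.2 (by linarith)
    have := Real.exp_one_lt_d9
    gcongr
    linarith
  have h4 : |attn (b.input μ₁ μ₂) (gd (trainSet μ₁ μ₂ ω) β 2).2 b.noisePos *
      (b.y * inner ℝ (gd (trainSet μ₁ μ₂ ω) β 2).1 b.noise)| ≤ 1 := by
    rw [abs_mul, abs_mul, Draw.abs_y, one_mul, abs_of_pos (attn_pos _ _ _)]
    exact mul_le_one₀ (attn_le_one _ _ _) (abs_nonneg _) hv.le
  have h5 := mul_le_mul h3 h1 (by linarith) (attn_pos _ _ _).le
  have h6 := (abs_le.1 h4).1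
  linarith

lemma testError_le {η : ℝ} (h₀ : 0 ≤ η) (hη : η < 1 / 2) :
    testError η ρ μ₁ μ₂ (gd (trainSet μ₁ μ₂ ω) β 2).1 (gd (trainSet μ₁ μ₂ ω) β 2).2 ≤
      η + 3 * Real.exp (-(d : ℝ) / (2 * (K * R) ^ 4 * (n : ℝ) ^ 2)) := by
  have := isProbabilityMeasure_drawLaw (ρ := ρ) (μ₁ := μ₁) (μ₂ := μ₂) h₀ hη
  have hX := hs.le_KR
  have hn := hs.n_pos'
  have hd := hs.d_pos'
  set v := (gd (trainSet μ₁ μ₂ ω) β 2).1 with hvdef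
  set p := (gd (trainSet μ₁ μ₂ ω) β 2).2 with hpdef
  rw [testError, dataLaw, map_measureReal_apply (measurable_dataPoint μ₁ μ₂)
    (measurableSet_misclassified v p)]
  set B : Token d → Set (Token d) := fun w => {x | 1 ≤ inner ℝ w x} with hB
  have hBm : ∀ w, MeasurableSet (B w) := fun w => measurableSet_le (by fun_prop) (by fun_prop)
  have hsub : Draw.dataPoint μ₁ μ₂ ⁻¹' {z | z.2.toReal ≠ Real.sign (model v p z.1)} ⊆
      Draw.flip ⁻¹' {-1} ∪ (Draw.noise ⁻¹' B p ∪ (Draw.noise ⁻¹' B v ∪ Draw.noise ⁻¹' B (-v))) := by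
    intro b hb
    by_contra hc
    simp only [Set.mem_union, Set.mem_preimage, Set.mem_singleton_iff, hB, Set.mem_ofPred_eq,
      not_or, not_le, inner_neg_left] at hc
    obtain ⟨hf, hp, hv, hv'⟩ := hc
    exact hb (hs.label_eq_sign_test b ((Int.units_eq_one_or b.flip).resolve_right hf) hp
      (abs_lt.2 ⟨by linarith, hv⟩))
  have hflip : (drawLaw η ρ μ₁ μ₂).real (Draw.flip ⁻¹' {-1}) = η := by
    rw [(measurePreserving_flip h₀ hη).measureReal_preimage
      (measurableSet_singleton _).nullMeasurableSet, flipLaw_neg_one h₀]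
  have hnoise : ∀ w : Token d, ‖noiseProj ρ μ₁ μ₂ w‖ ^ 2 ≤ (K * R) ^ 4 * (n ^ 2 / d) →
      (drawLaw η ρ μ₁ μ₂).real (Draw.noise ⁻¹' B w) ≤
        Real.exp (-(d : ℝ) / (2 * (K * R) ^ 4 * (n : ℝ) ^ 2)) := by
    intro w hw
    rw [(measurePreserving_noise h₀ hη).measureReal_preimage (hBm w).nullMeasurableSet]
    refine (measureReal_inner_noise_ge hs.rho_pos hs.norm₁ hs.norm₂ hs.orth w (by positivity)
      zero_le_one hw).trans (Real.exp_le_exp.2 (le_of_eq ?_))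
    have : (K * R) ≠ 0 := by linarith
    generalize K * R = X at *
    field_simp
  refine (measureReal_mono hsub).trans ?_
  have e1 := measureReal_union_le (μ := drawLaw η ρ μ₁ μ₂) (Draw.flip ⁻¹' {-1})
    (Draw.noise ⁻¹' B p ∪ (Draw.noise ⁻¹' B v ∪ Draw.noise ⁻¹' B (-v)))
  have e2 := measureReal_union_le (μ := drawLaw η ρ μ₁ μ₂) (Draw.noise ⁻¹' B p)
    (Draw.noise ⁻¹' B v ∪ Draw.noise ⁻¹' B (-v))
  have e3 := measureReal_union_le (μ := drawLaw η ρ μ₁ μ₂) (Draw.noise ⁻¹' B v)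
    (Draw.noise ⁻¹' B (-v))
  have e4 := hnoise p hs.norm_sq_noiseProj_p_le
  have e5 := hnoise v hs.norm_sq_noiseProj_v_le
  have e6 := hnoise (-v) (by rw [map_neg, norm_neg]; exact hs.norm_sq_noiseProj_v_le)
  linarith

end Scaled

end

end AttentionGD

/-! ### Choice of the constants -/

theorem theorem1 (Cρ Cβ : ℝ) (hCρ : 6 ≤ Cρ) (hCβ : 16 ≤ Cβ) :
    ∃ C₁ : ℝ, 0 < C₁ ∧ ∃ C₀ : ℝ, 0 < C₀ ∧ ∀ C : ℝ, C₀ ≤ C →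
      ∀ (n d : ℕ) (δ η ρ β : ℝ) (μ₁ μ₂ : Token d),
        0 < δ → δ < 1 / 2 →
        C * Real.log (1 / δ) ≤ n →
        C * (n : ℝ) ^ 2 * Real.log (n / δ) ≤ d →
        ρ = Cρ * Real.sqrt ((d : ℝ) / n) →
        0 ≤ η → η < 1 / 2 → η ≤ 1 / C →
        β = Cβ * ((n : ℝ) / d) →
        0 < ρ → ‖μ₁‖ = ρ → ‖μ₂‖ = ρ → inner ℝ μ₁ μ₂ = 0 →
        1 - δ ≤ (trainLaw n η ρ μ₁ μ₂).real {ω |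
          let S := trainSet μ₁ μ₂ ω
          let v := (gd S β 2).1
          let p := (gd S β 2).2
          (∀ i ∈ cleanIdx ω, 1 / 2 < attn (S i).1 p (ω i).pos) ∧
          (∀ i ∈ noisyIdx ω, 1 - 1 / Cρ ^ 2 ≤ attn (S i).1 p (ω i).noisePos) ∧
          (∀ i, (S i).2.toReal = Real.sign (model v p (S i).1)) ∧
          testError η ρ μ₁ μ₂ v p ≤ η + Real.exp (-(d : ℝ) / (C₁ * (n : ℝ) ^ 2))} := by
  have hR : 36 ≤ Cρ ^ 2 := by nlinarith
  have hX : 0 < Cβ * Cρ ^ 2 := by positivity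
  set ε := Real.exp (-(Cβ * Cρ ^ 2 / 4)) / 100 with hε
  have hε0 : 0 < ε := by positivity
  have hε1 : ε ≤ 1 / 12 := by
    have : Real.exp (-(Cβ * Cρ ^ 2 / 4)) ≤ 1 := Real.exp_le_one_iff.2 (by linarith)
    linarith
  -- `C₁` is twice the constant of `Scaled.testError_le`, so half of the exponent can absorb the
  -- prefactor `3`. The summands of `C₀` serve the failure probability, `η ≤ ε / 2`, and `x ≥ 2 log
  -- 2` below.
  refine ⟨4 * (Cβ * Cρ ^ 2) ^ 4, by positivity,
    32 / ε ^ 2 + 2 / ε + 8 * (Cβ * Cρ ^ 2) ^ 4, by positivity, ?_⟩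
  intro C hC n d δ η ρ β μ₁ μ₂ hδ hδ' hn hd hρ hη0 hη hηC hβ hρ0 h₁ h₂ h
  have hp1 : 0 < 32 / ε ^ 2 := by positivity
  have hp2 : 0 < 2 / ε := by positivity
  have hp3 : 0 < (Cβ * Cρ ^ 2) ^ 4 := by positivity
  have hC1 : 32 / ε ^ 2 ≤ C := by linarith
  have hC2 : 2 / ε ≤ C := by linarith
  have hC3 : 8 * (Cβ * Cρ ^ 2) ^ 4 ≤ C := by linarith
  have hC0 : 0 < C := by linarith
  have hδ1 : 2 ≤ 1 / δ := by rw [le_div_iff₀ hδ]; linarith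
  have hn0 : 0 < n := by
    have : 0 < C * Real.log (1 / δ) := mul_pos hC0 (Real.log_pos (by linarith))
    exact_mod_cast this.trans_le hn
  have hn1 : (1 : ℝ) ≤ n := by exact_mod_cast hn0
  have hlog : Real.log 2 ≤ Real.log (n / δ) := by
    apply Real.log_le_log (by norm_num)
    rw [le_div_iff₀ hδ]
    linarith
  have hlog2 : 0 < Real.log 2 := Real.log_pos (by norm_num)
  have hd0 : 0 < d := by
    have : 0 < C * (n : ℝ) ^ 2 * Real.log (n / δ) :=
      mul_pos (by positivity) (hlog2.trans_le hlog)
    exact_mod_cast this.trans_le hd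
  have hηε : η ≤ ε / 2 := by
    refine hηC.trans ?_
    rw [div_le_iff₀ hC0]
    rw [div_le_iff₀ hε0] at hC2
    linarith
  have hprob : IsProbabilityMeasure (trainLaw n η ρ μ₁ μ₂) := by
    have := isProbabilityMeasure_drawLaw (ρ := ρ) (μ₁ := μ₁) (μ₂ := μ₂) hη0 hη
    unfold trainLaw
    infer_instance
  refine (measureReal_isGood_ge hη0 hη hρ0 h₁ h₂ h hε0 hε1 hηε hδ hδ' hC1 hn0 hd0 hn hd).trans
    (measureReal_mono ?_)
  intro ω hg
  have hs : Scaled ε ρ β Cβ (Cρ ^ 2) μ₁ μ₂ ω :=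
    { good := hg, rho_pos := hρ0, norm₁ := h₁, norm₂ := h₂, orth := h, n_pos := hn0, d_pos := hd0,
      le_K := hCβ, le_R := hR, beta_eq := hβ, eps_nonneg := hε0.le, eps_le := le_rfl,
      rho_sq := by rw [hρ, mul_pow, Real.sq_sqrt (by positivity)] }
  refine ⟨fun i hi => hs.half_lt_attn_signal i (flip_of_mem_cleanIdx hi),
    fun i hi => hs.le_attn_noise i (flip_of_mem_noisyIdx hi), fun i => hs.label_eq_sign i, ?_⟩
  refine (hs.testError_le hη0 hη).trans (add_le_add le_rfl ?_)
  set x := (d : ℝ) / (4 * (Cβ * Cρ ^ 2) ^ 4 * (n : ℝ) ^ 2) with hx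
  have e1 : -(d : ℝ) / (2 * (Cβ * Cρ ^ 2) ^ 4 * (n : ℝ) ^ 2) = -x + -x := by
    rw [hx]
    generalize (Cβ * Cρ ^ 2) ^ 4 = Y at *
    field_simp
    norm_num
  have e2 : 2 * Real.log 2 ≤ x := by
    rw [hx, le_div_iff₀ (by positivity)]
    refine le_trans ?_ hd
    calc 2 * Real.log 2 * (4 * (Cβ * Cρ ^ 2) ^ 4 * (n : ℝ) ^ 2)
        = 8 * (Cβ * Cρ ^ 2) ^ 4 * (n : ℝ) ^ 2 * Real.log 2 := by ring
      _ ≤ C * (n : ℝ) ^ 2 * Real.log (n / δ) := by gcongr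
  have e3 : Real.exp (-x) ≤ 1 / 4 := by
    calc Real.exp (-x) ≤ Real.exp (-(2 * Real.log 2)) := Real.exp_le_exp.2 (by linarith)
      _ = 1 / 4 := by
        rw [Real.exp_neg, two_mul, Real.exp_add, Real.exp_log (by norm_num)]
        norm_num
  rw [e1, Real.exp_add, neg_div, ← hx]
  -- `3 exp(-2x) ≤ exp(-x)` because `exp(-x) ≤ 1/4`.
  nlinarith [Real.exp_pos (-x)]
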